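/- In the fair $k$-center problem one is given a universe $\mathcal U$ of $n$ points with a pseudometric $d$, a partition $\mathcal U=\mathcal U_1\cup\dots\cup\mathcal U_m$ into $m$ pairwise disjoint classes, and non-negative integers $k_1,\dots,k_m$ with $k=k_1+\dots+k_m\ge 1$. A set $S\subseteq\mathcal U$ is \emph{fair} if $|S\cap\mathcal U_i|=k_i$ for all $i$, and its clustering radius is $r(S)=\max_{u\in\mathcal U}\min_{s\in S}d(u,s)$. The goal is to find a fair set of minimum radius. There is a 3-approximation algorithm for this problem with running time $O(kn+m^2k^2\log k)$. That is, there are a single program for a unit-cost random access machine (with natural-number and real memory, addition, subtraction, comparison and indirect addressing, halving of natural numbers, no multiplication, and distance queries $d(u,v)$ in unit time) and an absolute constant $C$ such that on every instance that has at least one fair set the program, given $n,m,k$, the class of each point and the numbers $k_i$, halts after at most $C\,(kn+m^2k^2\log k)$ steps and outputs a fair set $S$ with $r(S)\le 3\,r(T)$ for every fair set $T$. -/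

import Mathlib

namespace FairKCenter

/-! ### The fair `k`-center problem -/

/-- An instance: a universe of `n` points with a pseudometric, each point in exactly one of `m`
classes (the fibres of `color`), and the required number `quota i` of centers of class `i`. -/
structure Problem where
  n : ℕ
  m : ℕ
  color : Fin n → Fin m
  quota : Fin m → ℕ
  dist : Fin n → Fin n → ℝ
  dist_nonneg : ∀ u v, 0 ≤ dist u v
  dist_self : ∀ u, dist u u = 0
  dist_comm : ∀ u v, dist u v = dist v u
  dist_triangle : ∀ u v w, dist u v ≤ dist u w + dist w v

namespace Problem

/-- The total number of centers. -/
def k (I : Problem) : ℕ := ∑ i, I.quota i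

/-- `S` contains exactly `quota i` points of each class `i`. -/
def IsFair (I : Problem) (S : Finset (Fin I.n)) : Prop :=
  ∀ i, (S.filter fun u => I.color u = i).card = I.quota i

/-- The clustering radius `max_u min_{s ∈ S} d(u, s)` (used for nonempty `S` only). -/
noncomputable def radius (I : Problem) (S : Finset (Fin I.n)) : ℝ :=
  ⨆ u : Fin I.n, ⨅ s : S, I.dist u s

/-- `S` is a fair set of centers whose radius is at most `α` times that of every fair set. -/
def IsApprox (I : Problem) (α : ℝ) (S : Finset (Fin I.n)) : Prop :=
  I.IsFair S ∧ ∀ T, I.IsFair T → I.radius S ≤ α * I.radius T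

end Problem

/-! ### A random access machine with distance queries

Programs are finite and structured. The memory consists of natural number registers, natural number
arrays, real registers and real arrays; a program can name only finitely many registers and arrays,
and array cells are addressed indirectly. Every elementary operation takes one unit of time: on
natural numbers, addition, truncated subtraction, halving and comparison (there is no
multiplication, so a step adds at most one bit to the length of the numbers in memory); on real
numbers, addition, subtraction and comparison; reading or writing a register or an array cell;
querying the distance of two points, which are referred to by their indices. There is no
conversion between real and natural numbers. -/

structure State where
  nreg : ℕ → ℕ
  narr : ℕ → ℕ → ℕ
  rreg : ℕ → ℝ
  rarr : ℕ → ℕ → ℝ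

/-- Expressions with values in the natural numbers. -/
inductive NExp where
  | const (c : ℕ)
  | reg (x : ℕ)
  | arr (a : ℕ) (idx : NExp)
  | add (e f : NExp)
  | sub (e f : NExp)
  | half (e : NExp)

def NExp.eval (s : State) : NExp → ℕ
  | const c => c
  | reg x => s.nreg x
  | arr a idx => s.narr a (idx.eval s)
  | add e f => e.eval s + f.eval s
  | sub e f => e.eval s - f.eval s
  | half e => e.eval s / 2

def NExp.cost : NExp → ℕ
  | const _ => 1
  | reg _ => 1
  | arr _ idx => idx.cost + 1
  | add e f => e.cost + f.cost + 1
  | sub e f => e.cost + f.cost + 1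
  | half e => e.cost + 1

/-- Expressions with values in the real numbers. -/
inductive RExp where
  | reg (x : ℕ)
  | arr (a : ℕ) (idx : NExp)
  | dist (p q : NExp)
  | add (e f : RExp)
  | sub (e f : RExp)

/-- `d` is the distance oracle. -/
noncomputable def RExp.eval (d : ℕ → ℕ → ℝ) (s : State) : RExp → ℝ
  | reg x => s.rreg x
  | arr a idx => s.rarr a (idx.eval s)
  | dist p q => d (p.eval s) (q.eval s)
  | add e f => e.eval d s + f.eval d s
  | sub e f => e.eval d s - f.eval d s

def RExp.cost : RExp → ℕ
  | reg _ => 1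
  | arr _ idx => idx.cost + 1
  | dist p q => p.cost + q.cost + 1
  | add e f => e.cost + f.cost + 1
  | sub e f => e.cost + f.cost + 1

/-- Tests. -/
inductive BExp where
  | nle (e f : NExp)
  | rle (e f : RExp)
  | not (b : BExp)
  | and (b c : BExp)

def BExp.eval (d : ℕ → ℕ → ℝ) (s : State) : BExp → Prop
  | nle e f => e.eval s ≤ f.eval s
  | rle e f => e.eval d s ≤ f.eval d s
  | not b => ¬ b.eval d s
  | and b c => b.eval d s ∧ c.eval d s

def BExp.cost : BExp → ℕ
  | nle e f => e.cost + f.cost + 1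
  | rle e f => e.cost + f.cost + 1
  | not b => b.cost + 1
  | and b c => b.cost + c.cost + 1

/-- Programs. -/
inductive Prog where
  | skip
  | nset (x : ℕ) (e : NExp)
  | nstore (a : ℕ) (idx e : NExp)
  | rset (x : ℕ) (e : RExp)
  | rstore (a : ℕ) (idx : NExp) (e : RExp)
  | seq (P Q : Prog)
  | ite (b : BExp) (P Q : Prog)
  | loop (b : BExp) (P : Prog)

/-- `Exec d P s t s'`: started in memory state `s` with distance oracle `d`, the program `P` halts
after exactly `t` units of time in state `s'`. Here `loop b P` is "while `b` do `P`". -/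
inductive Exec (d : ℕ → ℕ → ℝ) : Prog → State → ℕ → State → Prop where
  | skip (s : State) : Exec d .skip s 1 s
  | nset (s : State) (x : ℕ) (e : NExp) :
      Exec d (.nset x e) s (e.cost + 1)
        { s with nreg := Function.update s.nreg x (e.eval s) }
  | nstore (s : State) (a : ℕ) (idx e : NExp) :
      Exec d (.nstore a idx e) s (idx.cost + e.cost + 1)
        { s with narr := Function.update s.narr a
                  (Function.update (s.narr a) (idx.eval s) (e.eval s)) }
  | rset (s : State) (x : ℕ) (e : RExp) :
      Exec d (.rset x e) s (e.cost + 1)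
        { s with rreg := Function.update s.rreg x (e.eval d s) }
  | rstore (s : State) (a : ℕ) (idx : NExp) (e : RExp) :
      Exec d (.rstore a idx e) s (idx.cost + e.cost + 1)
        { s with rarr := Function.update s.rarr a
                  (Function.update (s.rarr a) (idx.eval s) (e.eval d s)) }
  | seq {P Q : Prog} {s s' s'' : State} {t t' : ℕ} :
      Exec d P s t s' → Exec d Q s' t' s'' → Exec d (.seq P Q) s (t + t') s''
  | ite_true {b : BExp} {P Q : Prog} {s s' : State} {t : ℕ} :
      b.eval d s → Exec d P s t s' → Exec d (.ite b P Q) s (b.cost + t) s'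
  | ite_false {b : BExp} {P Q : Prog} {s s' : State} {t : ℕ} :
      ¬ b.eval d s → Exec d Q s t s' → Exec d (.ite b P Q) s (b.cost + t) s'
  | loop_true {b : BExp} {P : Prog} {s s' s'' : State} {t t' : ℕ} :
      b.eval d s → Exec d P s t s' → Exec d (.loop b P) s' t' s'' →
      Exec d (.loop b P) s (b.cost + t + t') s''
  | loop_false {b : BExp} {P : Prog} {s : State} :
      ¬ b.eval d s → Exec d (.loop b P) s b.cost s

/-! ### Input and output -/

/-- The distance oracle of an instance (zero for indices that are not points). -/
noncomputable def Problem.oracle (I : Problem) (p q : ℕ) : ℝ :=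
  if h : p < I.n ∧ q < I.n then I.dist ⟨p, h.1⟩ ⟨q, h.2⟩ else 0

/-- The initial memory: registers `0, 1, 2` hold `n, m, k`, array `0` holds the class of each
point, array `1` the quota of each class, and everything else is zero. -/
def Problem.input (I : Problem) : State where
  nreg x := if x = 0 then I.n else if x = 1 then I.m else if x = 2 then I.k else 0
  narr a j :=
    if a = 0 then (if h : j < I.n then (I.color ⟨j, h⟩ : ℕ) else 0)
    else if a = 1 then (if h : j < I.m then I.quota ⟨j, h⟩ else 0)
    else 0
  rreg _ := 0
  rarr _ _ := 0

/-- The memory state `s` presents the set `S` of points as output: the first `k` cells of array `2`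
are the indices of the elements of `S`. -/
def Problem.Outputs (I : Problem) (s : State) (S : Finset (Fin I.n)) : Prop :=
  (Finset.range I.k).image (s.narr 2) = S.map Fin.valEmbedding

/-- On the instance `I`, the program `P` halts within time `T` and outputs an `α`-approximate
solution. -/
def Problem.SolvedBy (I : Problem) (P : Prog) (α T : ℝ) : Prop :=
  ∃ (t : ℕ) (s : State) (S : Finset (Fin I.n)),
    Exec I.oracle P I.input t s ∧ (t : ℝ) ≤ T ∧ I.Outputs s S ∧ I.IsApprox α S

end FairKCenter

/-!
Farthest-point traversal chooses pivots `p₀, p₁, …`, and round `j` extends an assignment of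
`p₀, …, p_{j-1}` to classes that respects the quotas to `p_j`, along an augmenting path in the
bipartite graph of pivots and classes; the edge from `p_l` to the class `c` stands for the point of
`c` nearest to `p_l`, which becomes the center of `p_l`. The path is found by a search in the
manner of Prim, which always follows a shortest edge leaving the classes reached so far.

Let `r` be the optimal radius. If the pivots are pairwise more than `2r` apart, an optimal fair set
serves them by distinct centers within distance `r`. When all classes reached so far are full, there
is one more reached pivot than there are places in these classes, so one of those centers is in
another class and some leaving edge has length at most `r`. Hence, if a shortest leaving edge is
longer than half the distance of `p_j` to the earlier pivots, then every point is within `2r` of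
an earlier pivot and the traversal may end; otherwise all centers stay within `r` of their pivots.
In the end every point is within `3r` of a center, and completing the centers greedily to a fair
set preserves this.
-/

namespace FairKCenter

/-- A place in memory that a program can write to: a register or a whole array. -/
inductive Loc where
  | nreg (x : ℕ)
  | narr (a : ℕ)
  | rreg (x : ℕ)
  | rarr (a : ℕ)
  deriving DecidableEq

/-- The places to which a program may write. -/
def Prog.writes : Prog → List Loc
  | skip => []
  | nset x _ => [.nreg x]
  | nstore a _ _ => [.narr a]
  | rset x _ => [.rreg x]
  | rstore a _ _ => [.rarr a]
  | seq P Q => P.writes ++ Q.writes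
  | ite _ P Q => P.writes ++ Q.writes
  | loop _ P => P.writes

/-- The states `s` and `s'` agree outside the places in `W`. Membership in a concrete list is left
to `decide`, so that the fields turn reading from `s'` into reading from `s`. -/
structure EqOff (W : List Loc) (s s' : State) : Prop where
  nreg : ∀ x, (hx : .nreg x ∉ W := by decide) → s'.nreg x = s.nreg x
  narr : ∀ a, (ha : .narr a ∉ W := by decide) → s'.narr a = s.narr a
  rreg : ∀ x, (hx : .rreg x ∉ W := by decide) → s'.rreg x = s.rreg x
  rarr : ∀ a, (ha : .rarr a ∉ W := by decide) → s'.rarr a = s.rarr a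

namespace EqOff

variable {W W' : List Loc} {s s' s'' : State}

theorem refl (W : List Loc) (s : State) : EqOff W s s :=
  ⟨fun _ _ => rfl, fun _ _ => rfl, fun _ _ => rfl, fun _ _ => rfl⟩

theorem mono (h : EqOff W s s') (hW : W ⊆ W') : EqOff W' s s' :=
  ⟨fun x hx => h.nreg x (mt (hW ·) hx), fun a ha => h.narr a (mt (hW ·) ha),
    fun x hx => h.rreg x (mt (hW ·) hx), fun a ha => h.rarr a (mt (hW ·) ha)⟩

theorem trans (h : EqOff W s s') (h' : EqOff W s' s'') : EqOff W s s'' :=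
  ⟨fun x hx => (h'.nreg x hx).trans (h.nreg x hx), fun a ha => (h'.narr a ha).trans (h.narr a ha),
    fun x hx => (h'.rreg x hx).trans (h.rreg x hx), fun a ha => (h'.rarr a ha).trans (h.rarr a ha)⟩

end EqOff

section

variable {d : ℕ → ℕ → ℝ} {P Q : Prog} {s s' : State} {t T T' : ℕ} {R R' : State → Prop}

theorem Exec.eqOff (h : Exec d P s t s') : EqOff P.writes s s' := by
  induction h with
  | skip => exact .refl _ _
  | nset s x e =>
    exact ⟨fun y hy => Function.update_of_ne (by simpa [Prog.writes] using hy) _ _,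
      fun _ _ => rfl, fun _ _ => rfl, fun _ _ => rfl⟩
  | nstore s a i e =>
    exact ⟨fun _ _ => rfl, fun y hy => Function.update_of_ne (by simpa [Prog.writes] using hy) _ _,
      fun _ _ => rfl, fun _ _ => rfl⟩
  | rset s x e =>
    exact ⟨fun _ _ => rfl, fun _ _ => rfl,
      fun y hy => Function.update_of_ne (by simpa [Prog.writes] using hy) _ _, fun _ _ => rfl⟩
  | rstore s a i e =>
    exact ⟨fun _ _ => rfl, fun _ _ => rfl, fun _ _ => rfl,
      fun y hy => Function.update_of_ne (by simpa [Prog.writes] using hy) _ _⟩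
  | seq _ _ ih ih' =>
    exact (ih.mono (List.subset_append_left _ _)).trans (ih'.mono (List.subset_append_right _ _))
  | ite_true _ _ ih => exact ih.mono (List.subset_append_left _ _)
  | ite_false _ _ ih => exact ih.mono (List.subset_append_right _ _)
  | loop_true _ _ _ ih ih' => exact ih.trans ih'
  | loop_false => exact .refl _ _

/-- Total correctness: started in `s`, the program `P` halts within time `T` in a state that
satisfies `R`. -/
def HaltsWithin (d : ℕ → ℕ → ℝ) (P : Prog) (s : State) (T : ℕ) (R : State → Prop) : Prop :=
  ∃ t s', Exec d P s t s' ∧ t ≤ T ∧ R s'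

namespace HaltsWithin

theorem mono (h : HaltsWithin d P s T R) (hT : T ≤ T')
    (hR : ∀ s', EqOff P.writes s s' → R s' → R' s') : HaltsWithin d P s T' R' := by
  obtain ⟨t, s', hP, ht, hs⟩ := h
  exact ⟨t, s', hP, ht.trans hT, hR s' hP.eqOff hs⟩

theorem seq (h : HaltsWithin d P s T R)
    (h' : ∀ s', EqOff P.writes s s' → R s' → HaltsWithin d Q s' T' R') :
    HaltsWithin d (P.seq Q) s (T + T') R' := by
  obtain ⟨t, s', hP, ht, hs⟩ := h
  obtain ⟨t', s'', hQ, ht', hs'⟩ := h' s' hP.eqOff hs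
  exact ⟨_, s'', hP.seq hQ, Nat.add_le_add ht ht', hs'⟩

theorem ite {b : BExp} (h : b.eval d s → HaltsWithin d P s T R)
    (h' : ¬ b.eval d s → HaltsWithin d Q s T R) :
    HaltsWithin d (.ite b P Q) s (b.cost + T) R := by
  by_cases hb : b.eval d s
  · obtain ⟨t, s', hP, ht, hs⟩ := h hb
    exact ⟨_, s', .ite_true hb hP, Nat.add_le_add_left ht _, hs⟩
  · obtain ⟨t, s', hQ, ht, hs⟩ := h' hb
    exact ⟨_, s', .ite_false hb hQ, Nat.add_le_add_left ht _, hs⟩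

theorem loop {b : BExp} (R : State → Prop) (v : State → ℕ) (h₀ : R s)
    (step : ∀ s', EqOff P.writes s s' → R s' → b.eval d s' →
      HaltsWithin d P s' T fun s'' => R s'' ∧ v s'' < v s') :
    HaltsWithin d (.loop b P) s (v s * (b.cost + T) + b.cost) fun s' => R s' ∧ ¬ b.eval d s' := by
  induction hv : v s using Nat.strong_induction_on generalizing s with
  | _ V ih =>
    by_cases hb : b.eval d s
    · obtain ⟨t, s', hP, ht, hR', hlt⟩ := step s (.refl _ _) h₀ hb
      obtain ⟨t', s'', hloop, ht', hs''⟩ :=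
        ih (v s') (hv ▸ hlt) hR' (fun s'' h => step s'' (hP.eqOff.trans h)) rfl
      refine ⟨_, s'', .loop_true hb hP hloop, ?_, hs''⟩
      have : (v s' + 1) * (b.cost + T) ≤ V * (b.cost + T) := Nat.mul_le_mul_right _ (hv ▸ hlt)
      rw [Nat.succ_mul] at this
      omega
    · exact ⟨_, s, .loop_false hb, Nat.le_add_left _ _, h₀, hb⟩

end HaltsWithin

/-- The state `s` with natural number register `x` set to `v`. -/
def State.setReg (s : State) (x v : ℕ) : State :=
  { s with nreg := Function.update s.nreg x v }

theorem State.setReg_nreg_self (s : State) (x v : ℕ) : (s.setReg x v).nreg x = v := by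
  simp [State.setReg]

theorem State.eqOff_setReg (s : State) (x v : ℕ) : EqOff [.nreg x] s (s.setReg x v) :=
  (Exec.nset (d := fun _ _ => 0) s x (.const v)).eqOff

/-- `for x = 0, …, N - 1 do P`. -/
def Prog.forTo (x : ℕ) (N : NExp) (P : Prog) : Prog :=
  seq (nset x (.const 0))
    (loop (.not (.nle N (.reg x))) (seq P (nset x (.add (.reg x) (.const 1)))))

theorem HaltsWithin.forTo {x : ℕ} {N : NExp} (B : ℕ) (R : ℕ → State → Prop)
    (hx : .nreg x ∉ P.writes)
    (hN : ∀ s', EqOff (.nreg x :: P.writes) s s' → N.eval s' = B)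
    (hR : ∀ i s' v, R i s' → R i (s'.setReg x v)) (h₀ : R 0 s)
    (step : ∀ i s', EqOff (.nreg x :: P.writes) s s' → i < B → s'.nreg x = i → R i s' →
      HaltsWithin d P s' T (R (i + 1))) :
    HaltsWithin d (.forTo x N P) s (B * (N.cost + T + 7) + (N.cost + 5)) (R B) := by
  have setReg_of {s₁ : State} (h : EqOff (.nreg x :: P.writes) s s₁) (v : ℕ) :
      EqOff (.nreg x :: P.writes) s (s₁.setReg x v) :=
    h.trans ((s₁.eqOff_setReg x v).mono (by simp))
  have body (s₁ : State) (h₁ : EqOff (.nreg x :: P.writes) s s₁)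
      (hlt : s₁.nreg x < B) (hR₁ : R (s₁.nreg x) s₁) :
      HaltsWithin d (P.seq (.nset x (.add (.reg x) (.const 1)))) s₁ (T + 4) fun s₂ =>
        (EqOff (.nreg x :: P.writes) s s₂ ∧ s₂.nreg x ≤ B ∧ R (s₂.nreg x) s₂) ∧
          B - s₂.nreg x < B - s₁.nreg x := by
    refine (step _ s₁ h₁ hlt rfl hR₁).seq fun s₂ h₂ hR₂ => ⟨_, _, .nset s₂ x _, le_rfl, ?_⟩
    change (EqOff _ s (s₂.setReg x (s₂.nreg x + 1)) ∧ (s₂.setReg x (s₂.nreg x + 1)).nreg x ≤ B ∧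
      R ((s₂.setReg x (s₂.nreg x + 1)).nreg x) (s₂.setReg x (s₂.nreg x + 1))) ∧
      B - (s₂.setReg x (s₂.nreg x + 1)).nreg x < _
    rw [State.setReg_nreg_self, h₂.nreg x hx]
    exact ⟨⟨setReg_of (h₁.trans (h₂.mono (by simp))) _, hlt, hR _ _ _ hR₂⟩, by omega⟩
  have init : Exec d (.nset x (.const 0)) s 2 (s.setReg x 0) := .nset s x (.const 0)
  obtain ⟨t, s', hloop, ht, ⟨hs', hle, hRs'⟩, hend⟩ :=
    HaltsWithin.loop (b := .not (.nle N (.reg x))) (s := s.setReg x 0)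
      (fun s' => EqOff (.nreg x :: P.writes) s s' ∧ s'.nreg x ≤ B ∧ R (s'.nreg x) s')
      (fun s' => B - s'.nreg x)
      ⟨setReg_of (.refl _ _) 0, by simp [State.setReg], by
        rw [State.setReg_nreg_self]; exact hR _ _ _ h₀⟩
      (fun s₁ _ ⟨h₁, _, hR₁⟩ hb => body s₁ h₁
        (by simpa [BExp.eval, NExp.eval, hN s₁ h₁] using hb) hR₁)
  refine ⟨_, s', init.seq hloop, ?_, ?_⟩
  · rw [State.setReg_nreg_self] at ht
    simp only [BExp.cost, NExp.cost, Nat.sub_zero] at ht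
    have : N.cost + 1 + 1 + 1 + (T + 4) = N.cost + T + 7 := by omega
    rw [this] at ht
    omega
  · have hend : B ≤ s'.nreg x := by simpa [BExp.eval, NExp.eval, hN s' hs'] using hend
    rwa [le_antisymm hle hend] at hRs'

/-- Programs without loops. -/
def Prog.LoopFree : Prog → Prop
  | seq P Q => P.LoopFree ∧ Q.LoopFree
  | ite _ P Q => P.LoopFree ∧ Q.LoopFree
  | loop _ _ => False
  | _ => True

/-- A bound for the running time of a loop-free program. -/
def Prog.time : Prog → ℕ
  | skip => 1
  | nset _ e => e.cost + 1
  | nstore _ i e => i.cost + e.cost + 1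
  | rset _ e => e.cost + 1
  | rstore _ i e => i.cost + e.cost + 1
  | seq P Q => P.time + Q.time
  | ite b P Q => b.cost + max P.time Q.time
  | loop _ _ => 0

open Classical in
/-- The state in which a loop-free program halts. -/
noncomputable def Prog.final (d : ℕ → ℕ → ℝ) : Prog → State → State
  | skip, s => s
  | nset x e, s => { s with nreg := Function.update s.nreg x (e.eval s) }
  | nstore a i e, s =>
      { s with narr := Function.update s.narr a (Function.update (s.narr a) (i.eval s) (e.eval s)) }
  | rset x e, s => { s with rreg := Function.update s.rreg x (e.eval d s) }
  | rstore a i e, s =>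
      { s with
        rarr := Function.update s.rarr a (Function.update (s.rarr a) (i.eval s) (e.eval d s)) }
  | seq P Q, s => Q.final d (P.final d s)
  | ite b P Q, s => if b.eval d s then P.final d s else Q.final d s
  | loop _ _, s => s

theorem Prog.LoopFree.haltsWithin (hP : P.LoopFree) (s : State) :
    HaltsWithin d P s P.time (· = P.final d s) := by
  induction P generalizing s with
  | skip => exact ⟨_, _, .skip s, le_rfl, rfl⟩
  | nset x e => exact ⟨_, _, .nset s x e, le_rfl, rfl⟩
  | nstore a i e => exact ⟨_, _, .nstore s a i e, le_rfl, rfl⟩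
  | rset x e => exact ⟨_, _, .rset s x e, le_rfl, rfl⟩
  | rstore a i e => exact ⟨_, _, .rstore s a i e, le_rfl, rfl⟩
  | seq P Q ihP ihQ => exact (ihP hP.1 s).seq fun s' _ hs' => hs' ▸ ihQ hP.2 s'
  | ite b P Q ihP ihQ =>
    refine .ite (fun hb => ?_) fun hb => ?_
    · simpa only [final, if_pos hb] using (ihP hP.1 s).mono (le_max_left _ _) fun _ _ h => h
    · simpa only [final, if_neg hb] using (ihQ hP.2 s).mono (le_max_right _ _) fun _ _ h => h
  | loop => exact hP.elim

theorem HaltsWithin.of_loopFree (hP : P.LoopFree) (hT : P.time ≤ T) (hR : R (P.final d s)) :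
    HaltsWithin d P s T R :=
  (hP.haltsWithin s).mono hT fun _ _ h => h ▸ hR

end

open Finset

namespace Problem

/-- The class of the point with a given index, as stored in the input. -/
def col (I : Problem) : ℕ → ℕ := I.input.narr 0

/-- The quota of the class with a given index, as stored in the input; it is `0` for indices that
are not classes. -/
def quo (I : Problem) : ℕ → ℕ := I.input.narr 1

/-- `T` is the set of indices of the points of a fair set of radius at most `r`. -/
structure Cover (I : Problem) (T : Finset ℕ) (r : ℝ) : Prop where
  lt : ∀ t ∈ T, t < I.n
  fair : ∀ i, #{t ∈ T | I.col t = i} = I.quo i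
  cover : ∀ u < I.n, ∃ t ∈ T, I.oracle u t ≤ r

variable {I : Problem}

theorem col_val (u : Fin I.n) : I.col u = I.color u := by
  simp [col, input]

theorem quo_val (i : Fin I.m) : I.quo i = I.quota i := by
  simp [quo, input]

theorem quo_of_le {i : ℕ} (hi : I.m ≤ i) : I.quo i = 0 := by
  simp [quo, input, hi.not_gt]

theorem col_lt {u : ℕ} (hu : u < I.n) : I.col u < I.m :=
  (col_val ⟨u, hu⟩).trans_lt (I.color _).2

theorem sum_quo : ∑ i ∈ range I.m, I.quo i = I.k := by
  rw [Finset.sum_range, k]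
  exact Finset.sum_congr rfl fun i _ => quo_val i

theorem oracle_val (u v : Fin I.n) : I.oracle u v = I.dist u v := by
  simp [oracle]

theorem oracle_nonneg (u v : ℕ) : 0 ≤ I.oracle u v := by
  unfold oracle
  split_ifs
  · exact I.dist_nonneg _ _
  · exact le_rfl

theorem oracle_comm (u v : ℕ) : I.oracle u v = I.oracle v u := by
  unfold oracle
  split_ifs with h h' h'
  · exact I.dist_comm _ _
  · exact absurd h.symm h'
  · exact absurd h'.symm h
  · rfl

theorem oracle_triangle {u v w : ℕ} (hu : u < I.n) (hv : v < I.n) (hw : w < I.n) :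
    I.oracle u v ≤ I.oracle u w + I.oracle w v := by
  simp only [oracle, hu, hv, hw, and_self, dite_true]
  exact I.dist_triangle _ _ _

theorem card_le_card_of_separated {P : ℕ → ℕ} {R T : Finset ℕ} {r : ℝ}
    (hP : ∀ l ∈ R, P l < I.n) (hT : ∀ t ∈ T, t < I.n)
    (hsep : (R : Set ℕ).Pairwise fun l l' => 2 * r < I.oracle (P l) (P l'))
    (hnear : ∀ l ∈ R, ∃ t ∈ T, I.oracle (P l) t ≤ r) : #R ≤ #T := by
  refine card_le_card_of_forall_subsingleton (fun l t => I.oracle (P l) t ≤ r) hnear ?_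
  rintro t ht l ⟨hl, hlt⟩ l' ⟨hl', hlt'⟩
  by_contra hne
  have hfar := hsep hl hl' hne
  have htri := oracle_triangle (hP l hl) (hP l' hl') (hT t ht)
  rw [oracle_comm t] at htri
  linarith

theorem Cover.card_filter_mem {T : Finset ℕ} {r : ℝ} (h : I.Cover T r) (Q : Finset ℕ) :
    #{t ∈ T | I.col t ∈ Q} = ∑ i ∈ Q, I.quo i := by
  rw [← sum_card_fiberwise_eq_card_filter]
  exact Finset.sum_congr rfl fun i _ => h.fair i

theorem Cover.card_eq {T : Finset ℕ} {r : ℝ} (h : I.Cover T r) : #T = I.k := by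
  rw [← sum_quo, ← h.card_filter_mem, filter_true_of_mem]
  exact fun t ht => mem_range.2 (col_lt (h.lt t ht))

end Problem

/-- The number of `l < J` that are assigned to `c` by `a`. -/
def load (a : ℕ → ℕ) (J c : ℕ) : ℕ := #{l ∈ range J | a l = c}

theorem load_update (a : ℕ → ℕ) {J l : ℕ} (hl : l < J) (i c : ℕ) :
    load (Function.update a l i) J c + (if c = a l then 1 else 0) =
      load a J c + if c = i then 1 else 0 := by
  have load_eq (b : ℕ → ℕ) : load b J c =
      (if b l = c then 1 else 0) + ∑ x ∈ (range J).erase l, if b x = c then 1 else 0 := by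
    rw [load, card_filter, ← add_sum_erase _ _ (mem_range.2 hl)]
  have rest : ∑ x ∈ (range J).erase l, (if Function.update a l i x = c then 1 else 0) =
      ∑ x ∈ (range J).erase l, if a x = c then 1 else 0 :=
    sum_congr rfl fun x hx => by rw [Function.update_of_ne (ne_of_mem_erase hx)]
  rw [load_eq, load_eq, rest, Function.update_self]
  grind

theorem load_update_succ (a : ℕ → ℕ) (J i c : ℕ) :
    load (Function.update a J i) (J + 1) c = load a J c + if c = i then 1 else 0 := by
  have rest : {l ∈ range J | Function.update a J i l = c} = {l ∈ range J | a l = c} :=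
    filter_congr fun l hl => by rw [Function.update_of_ne (mem_range.1 hl).ne]
  rw [load, range_add_one, filter_insert, Function.update_self, rest]
  split_ifs with h h' h'
  · rw [card_insert_of_notMem (by simp), load]
  · exact absurd h.symm h'
  · exact absurd h'.symm h
  · rfl

theorem ne_of_load_eq_zero {a : ℕ → ℕ} {J c l : ℕ} (h : load a J c = 0) (hl : l < J) :
    a l ≠ c := by
  rw [load, card_eq_zero, filter_eq_empty_iff] at h
  exact h (mem_range.2 hl)

theorem sum_load (a : ℕ → ℕ) (J : ℕ) (Q : Finset ℕ) :
    ∑ c ∈ Q, load a J c = #{l ∈ range J | a l ∈ Q} :=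
  sum_card_fiberwise_eq_card_filter _ Q a

/-- A search from class `m`: class `i < m` was reached at time `time i` (`0` means never), along the
edge `via i`, from the class of a pivot that was reached before. Edge `e` joins the pivot `pv e` to
the class of the point `pt e - 1`, and only edges for which `G` holds are used. -/
def SearchTree (col : ℕ → ℕ) (G : ℕ → ℕ → Prop) (m J : ℕ) (a pv pt time via : ℕ → ℕ) : Prop :=
  ∀ i < m, time i ≠ 0 → pv (via i) < J ∧ time (a (pv (via i))) ≠ 0 ∧
    time (a (pv (via i))) < time i ∧ col (pt (via i) - 1) = i ∧ G (pv (via i)) (pt (via i) - 1)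

/-- The classes reached by a search, including the dummy class `m`. -/
def reached (m : ℕ) (time : ℕ → ℕ) : Finset ℕ := {c ∈ range (m + 1) | time c ≠ 0}

theorem mem_reached {m c : ℕ} {time : ℕ → ℕ} : c ∈ reached m time ↔ c ≤ m ∧ time c ≠ 0 := by
  simp [reached]

/-- The edge `e` leads from a pivot assigned to a class in `Q` to a class that is not in `Q`. -/
def Leaves (col a pv pt : ℕ → ℕ) (Q : Finset ℕ) (e : ℕ) : Prop :=
  pt e ≠ 0 ∧ a (pv e) ∈ Q ∧ col (pt e - 1) ∉ Q

/-- The state of a search that has reached `clock` classes, one per unit of `clock`. -/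
structure SearchInv (col : ℕ → ℕ) (G : ℕ → ℕ → Prop) (m J : ℕ) (a pv pt time via : ℕ → ℕ)
    (clock : ℕ) : Prop where
  root : time m ≠ 0
  tree : SearchTree col G m J a pv pt time via
  le_clock : ∀ i ≤ m, time i ≤ clock
  card_reached : #(reached m time) = clock

namespace SearchInv

variable {col : ℕ → ℕ} {G : ℕ → ℕ → Prop} {m J clock e : ℕ} {a pv pt time via : ℕ → ℕ}

theorem start (hm : time m = 1) (h : ∀ i < m, time i = 0) :
    SearchInv col G m J a pv pt time via 1 where
  root := by simp [hm]
  tree i hi hne := absurd (h i hi) hne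
  le_clock i hi := by
    rcases hi.lt_or_eq with hi | rfl
    · simp [h i hi]
    · exact hm.le
  card_reached := by
    refine card_eq_one.2 ⟨m, ?_⟩
    ext c
    rw [mem_reached, mem_singleton]
    grind

theorem clock_le (h : SearchInv col G m J a pv pt time via clock) : clock ≤ m + 1 := by
  rw [← h.card_reached]
  exact (card_filter_le _ _).trans (card_range _).le

theorem reached_update {i : ℕ} (hi : i < m) (clock : ℕ) :
    reached m (Function.update time i (clock + 1)) = insert i (reached m time) := by
  ext c
  simp only [mem_insert, mem_reached, Function.update_apply]
  grind

theorem extend (h : SearchInv col G m J a pv pt time via clock)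
    (hL : Leaves col a pv pt (reached m time) e) (hi : col (pt e - 1) < m) (hJ : pv e < J)
    (hG : G (pv e) (pt e - 1)) :
    SearchInv col G m J a pv pt (Function.update time (col (pt e - 1)) (clock + 1))
      (Function.update via (col (pt e - 1)) e) (clock + 1) := by
  obtain ⟨-, hfrom, hnew⟩ := hL
  set i := col (pt e - 1) with hi_def
  have hi0 : time i = 0 := by
    by_contra h0
    exact hnew (mem_reached.2 ⟨hi.le, h0⟩)
  have time_old {c : ℕ} (hc : time c ≠ 0) : Function.update time i (clock + 1) c = time c :=
    Function.update_of_ne (by rintro rfl; exact hc hi0) _ _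
  obtain ⟨hle, hne⟩ := mem_reached.1 hfrom
  refine ⟨by rw [time_old h.root]; exact h.root, fun c hc hc0 => ?_, fun c hc => ?_, ?_⟩
  · by_cases hci : c = i
    · subst hci
      simp only [Function.update_self, time_old hne]
      exact ⟨hJ, hne, Nat.lt_succ_of_le (h.le_clock _ hle), hi_def.symm, hG⟩
    · simp only [Function.update_of_ne hci] at hc0 ⊢
      have := h.tree c hc hc0
      rwa [time_old this.2.1]
  · rw [Function.update_apply]
    split_ifs
    · exact le_rfl
    · exact (h.le_clock c hc).trans (Nat.le_succ _)
  · rw [reached_update hi, card_insert_of_notMem hnew, h.card_reached]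

end SearchInv

/-- An assignment `a` of pivots to classes, with centers `ctr`, in the middle of an augmentation:
it started from `a₀`, it is going to have the loads `L`, and class `hole` still lacks a pivot.
A pivot of the dummy class `m` has no center. -/
structure Augmenting (col : ℕ → ℕ) (G : ℕ → ℕ → Prop) (m J : ℕ) (time a₀ L a ctr : ℕ → ℕ)
    (hole : ℕ) : Prop where
  hole_le : hole ≤ m
  hole_reached : time hole ≠ 0
  assigned_le : ∀ l < J, a l ≤ m
  center : ∀ l < J, a l < m → col (ctr l) = a l ∧ G l (ctr l)
  load_eq : ∀ c, load a J c + (if c = hole then 1 else 0) = L c + if c = m then 1 else 0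
  untouched : ∀ l < J, a l = a₀ l ∨ time hole ≤ time (a₀ l)

namespace Augmenting

variable {col : ℕ → ℕ} {G : ℕ → ℕ → Prop} {m J hole : ℕ} {a₀ L a ctr time via pv pt : ℕ → ℕ}

theorem move (h : Augmenting col G m J time a₀ L a ctr hole)
    (hT : SearchTree col G m J a₀ pv pt time via) (hm : hole < m) :
    Augmenting col G m J time a₀ L (Function.update a (pv (via hole)) hole)
        (Function.update ctr (pv (via hole)) (pt (via hole) - 1)) (a (pv (via hole))) ∧
      time (a (pv (via hole))) < time hole := by
  obtain ⟨hJ, hne, hlt, hcol, hG⟩ := hT hole hm h.hole_reached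
  set l := pv (via hole)
  have hal : a l = a₀ l := (h.untouched l hJ).resolve_right hlt.not_ge
  refine ⟨⟨h.assigned_le l hJ, hal ▸ hne, fun x hx => ?_, fun x hx hxm => ?_, fun c => ?_,
    fun x hx => ?_⟩, hal ▸ hlt⟩
  · rcases eq_or_ne x l with rfl | hxl
    · simpa only [Function.update_self] using hm.le
    · simpa only [Function.update_of_ne hxl] using h.assigned_le x hx
  · rcases eq_or_ne x l with rfl | hxl
    · simpa only [Function.update_self] using ⟨hcol, hG⟩
    · simp only [Function.update_of_ne hxl] at hxm ⊢
      exact h.center x hx hxm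
  · rw [load_update a hJ, h.load_eq]
  · rcases eq_or_ne x l with rfl | hxl
    · exact .inr (hal ▸ le_rfl)
    · rw [Function.update_of_ne hxl]
      exact (h.untouched x hx).imp_right fun h' => (hal ▸ hlt.le).trans h'

theorem load_eq_of_le (h : Augmenting col G m J time a₀ L a ctr hole) (hm : m ≤ hole) (c : ℕ) :
    load a J c = L c := by
  have := h.load_eq c
  rw [le_antisymm h.hole_le hm] at this
  exact Nat.add_right_cancel this

theorem center_of_le (h : Augmenting col G m J time a₀ L a ctr hole) (hm : m ≤ hole)
    (hL : L m = 0) {l : ℕ} (hl : l < J) : a l < m ∧ col (ctr l) = a l ∧ G l (ctr l) := by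
  have hne : a l ≠ m := ne_of_load_eq_zero ((h.load_eq_of_le hm m).trans hL) hl
  have hlt := lt_of_le_of_ne (h.assigned_le l hl) hne
  exact ⟨hlt, h.center l hl hlt⟩

end Augmenting

/-- The edges for the first `j` pivots and, as far as the first `i` points are concerned, for pivot
`j`. Edge `l * m + c` joins pivot `l` to a point of class `c`; it belongs to the pivot `pv e` and
leads to the point `pt e - 1`, where `pt e = 0` means that there is no edge `e`. -/
structure EdgeTable (I : Problem) (P : ℕ → ℕ) (j i : ℕ) (pv pt : ℕ → ℕ) : Prop where
  sound : ∀ e, pt e ≠ 0 → pv e ≤ j ∧ pt e ≤ I.n ∧ e = pv e * I.m + I.col (pt e - 1)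
  nearest : ∀ l u, u < I.n → (l < j ∨ l = j ∧ u < i) → pt (l * I.m + I.col u) ≠ 0 ∧
    I.oracle (P l) (pt (l * I.m + I.col u) - 1) ≤ I.oracle (P l) u

/-- The length of edge `e`. -/
noncomputable def edgeLength (I : Problem) (P pv pt : ℕ → ℕ) (e : ℕ) : ℝ :=
  I.oracle (P (pv e)) (pt e - 1)

namespace EdgeTable

variable {I : Problem} {P pv pt : ℕ → ℕ} {j i l u e : ℕ}

theorem pred_lt (h : EdgeTable I P j i pv pt) (he : pt e ≠ 0) : pt e - 1 < I.n := by
  have := (h.sound e he).2.1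
  omega

theorem eq_of_index (h : EdgeTable I P j i pv pt) (hu : u < I.n)
    (he : pt (l * I.m + I.col u) ≠ 0) :
    pv (l * I.m + I.col u) = l ∧ I.col (pt (l * I.m + I.col u) - 1) = I.col u := by
  have heq := (h.sound _ he).2.2
  have hu' := Problem.col_lt hu
  have hv' := Problem.col_lt (h.pred_lt he)
  set c := I.col (pt (l * I.m + I.col u) - 1)
  set l' := pv (l * I.m + I.col u)
  have hm : 0 < I.m := by omega
  have hdiv := congrArg (· / I.m) heq
  have hmod := congrArg (· % I.m) heq
  simp only [Nat.mul_comm _ I.m, Nat.mul_add_div hm, Nat.mul_add_mod, Nat.div_eq_of_lt hu',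
    Nat.div_eq_of_lt hv', Nat.mod_eq_of_lt hu', Nat.mod_eq_of_lt hv'] at hdiv hmod
  exact ⟨hdiv.symm, hmod.symm⟩

theorem index_lt (hl : l ≤ j) (hu : u < I.n) : l * I.m + I.col u < j * I.m + I.m := by
  have := Problem.col_lt hu
  have := Nat.mul_le_mul_right I.m hl
  omega

theorem empty (I : Problem) (P pv : ℕ → ℕ) : EdgeTable I P 0 0 pv fun _ => 0 where
  sound e he := absurd rfl he
  nearest := by omega

theorem skip (h : EdgeTable I P j i pv pt) (hi : i < I.n) (he : pt (j * I.m + I.col i) ≠ 0)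
    (hle : edgeLength I P pv pt (j * I.m + I.col i) ≤ I.oracle (P j) i) :
    EdgeTable I P j (i + 1) pv pt where
  sound := h.sound
  nearest l u hu hlu := by
    by_cases hnew : l = j ∧ u = i
    · obtain ⟨rfl, rfl⟩ := hnew
      rw [edgeLength, (h.eq_of_index hi he).1] at hle
      exact ⟨he, hle⟩
    · exact h.nearest l u hu (by omega)

theorem insert (h : EdgeTable I P j i pv pt) (hi : i < I.n)
    (hlt : pt (j * I.m + I.col i) ≠ 0 →
      I.oracle (P j) i < edgeLength I P pv pt (j * I.m + I.col i)) :
    EdgeTable I P j (i + 1) (Function.update pv (j * I.m + I.col i) j)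
      (Function.update pt (j * I.m + I.col i) (i + 1)) where
  sound e he := by
    rcases eq_or_ne e (j * I.m + I.col i) with rfl | hne
    · simpa using Nat.succ_le_of_lt hi
    · simp only [Function.update_of_ne hne] at he ⊢
      exact h.sound e he
  nearest l u hu hlu := by
    rcases eq_or_ne (l * I.m + I.col u) (j * I.m + I.col i) with heq | hne
    · rw [heq, Function.update_self, Nat.add_sub_cancel]
      refine ⟨Nat.succ_ne_zero i, ?_⟩
      by_cases hnew : l = j ∧ u = i
      · rw [hnew.2]
      · obtain ⟨hpt, hle⟩ := h.nearest l u hu (by omega)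
        have hl := (h.eq_of_index hu hpt).1
        rw [heq] at hpt hle hl
        have := hlt hpt
        rw [edgeLength, hl] at this
        have hlj : l = j := hl.symm.trans (h.eq_of_index hi hpt).1
        subst hlj
        exact (this.trans_le hle).le
    · simp only [Function.update_of_ne hne]
      refine h.nearest l u hu ?_
      rcases hlu with hlj | ⟨rfl, hui⟩
      · exact .inl hlj
      · exact .inr ⟨rfl, lt_of_le_of_ne (Nat.le_of_lt_succ hui) (by rintro rfl; exact hne rfl)⟩

theorem next (h : EdgeTable I P j I.n pv pt) (q : ℕ) :
    EdgeTable I (Function.update P (j + 1) q) (j + 1) 0 pv pt where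
  sound e he := (h.sound e he).imp_left Nat.le_succ_of_le
  nearest l u hu hlu := by
    rw [Function.update_of_ne (by omega)]
    exact h.nearest l u hu (by omega)

end EdgeTable

/-- The pivots `P 0, …, P j` are the first `j + 1` points of a farthest-point traversal, and `near`
is the distance to the first `j` of them. -/
structure Traversal (I : Problem) (P : ℕ → ℕ) (j : ℕ) (near : ℕ → ℝ) : Prop where
  pivot_lt : ∀ l ≤ j, P l < I.n
  near_attained : j ≠ 0 → ∀ u < I.n, ∃ l < j, near u = I.oracle (P l) u
  near_le : ∀ l < j, ∀ u < I.n, near u ≤ I.oracle (P l) u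
  farthest : j ≠ 0 → ∀ u < I.n, near u ≤ near (P j)
  separated : (Set.Iic j).Pairwise fun l l' => near (P j) ≤ I.oracle (P l) (P l')

namespace Traversal

variable {I : Problem} {P : ℕ → ℕ} {j q : ℕ} {near near' : ℕ → ℝ}

theorem start (h : P 0 < I.n) (near : ℕ → ℝ) : Traversal I P 0 near where
  pivot_lt l hl := by rwa [Nat.le_zero.1 hl]
  near_attained h0 := absurd rfl h0
  near_le := by omega
  farthest h0 := absurd rfl h0
  separated l hl l' hl' hne := by
    simp only [Set.mem_Iic, Nat.le_zero] at hl hl'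
    omega

theorem updated_near_le (h : Traversal I P j near)
    (hnear : ∀ u < I.n, near' u =
      if j = 0 then I.oracle (P j) u else min (near u) (I.oracle (P j) u))
    {l u : ℕ} (hl : l ≤ j) (hu : u < I.n) : near' u ≤ I.oracle (P l) u := by
  rw [hnear u hu]
  rcases hl.lt_or_eq with hl | rfl
  · rw [if_neg (by omega)]
    exact (min_le_left _ _).trans (h.near_le l hl u hu)
  · split_ifs
    · exact le_rfl
    · exact min_le_right _ _

theorem next (h : Traversal I P j near)
    (hnear : ∀ u < I.n, near' u =
      if j = 0 then I.oracle (P j) u else min (near u) (I.oracle (P j) u))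
    (hq : q < I.n) (hmax : ∀ u < I.n, near' u ≤ near' q) :
    Traversal I (Function.update P (j + 1) q) (j + 1) near' := by
  have pivot_old {l : ℕ} (hl : l ≤ j) : Function.update P (j + 1) q l = P l :=
    Function.update_of_ne (Nat.lt_succ_of_le hl).ne _ _
  refine ⟨fun l hl => ?_, fun _ u hu => ?_, fun l hl u hu => ?_, fun _ u hu => ?_, ?_⟩
  · rcases hl.lt_or_eq with hl | rfl
    · rw [pivot_old (Nat.le_of_lt_succ hl)]
      exact h.pivot_lt l (Nat.le_of_lt_succ hl)
    · rwa [Function.update_self]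
  · rw [hnear u hu]
    split_ifs with hj
    · exact ⟨j, Nat.lt_succ_self j, by rw [pivot_old le_rfl]⟩
    · rcases min_choice (near u) (I.oracle (P j) u) with hmin | hmin <;> rw [hmin]
      · obtain ⟨l, hl, hl'⟩ := h.near_attained hj u hu
        exact ⟨l, hl.trans (Nat.lt_succ_self j), by rw [pivot_old hl.le, hl']⟩
      · exact ⟨j, Nat.lt_succ_self j, by rw [pivot_old le_rfl]⟩
  · rw [pivot_old (Nat.le_of_lt_succ hl)]
    exact h.updated_near_le hnear (Nat.le_of_lt_succ hl) hu
  · simpa only [Function.update_self] using hmax u hu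
  · rw [← Order.succ_eq_add_one, Order.Iic_succ, Order.succ_eq_add_one, Set.pairwise_insert]
    simp only [Function.update_self]
    refine ⟨fun l hl l' hl' hne => ?_, fun l hl _ => ?_⟩
    · beta_reduce
      rw [pivot_old hl, pivot_old hl']
      simp only [Set.mem_Iic] at hl hl'
      have hj : j ≠ 0 := by omega
      have le_near : near' q ≤ near q := by
        rw [hnear q hq, if_neg hj]
        exact min_le_left _ _
      exact le_near.trans ((h.farthest hj q hq).trans (h.separated hl hl' hne))
    · rw [pivot_old hl, Problem.oracle_comm q, and_self]
      exact h.updated_near_le hnear hl hq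

theorem exists_pivot_near (h : Traversal I P j near) (hj : j ≠ 0) {ρ : ℝ} (hρ : near (P j) ≤ ρ)
    {u : ℕ} (hu : u < I.n) : ∃ l < j, I.oracle u (P l) ≤ ρ := by
  obtain ⟨l, hl, hlu⟩ := h.near_attained hj u hu
  refine ⟨l, hl, ?_⟩
  rw [Problem.oracle_comm, ← hlu]
  exact (h.farthest hj u hu).trans hρ

end Traversal

namespace Problem.Cover

variable {I : Problem} {T : Finset ℕ} {r : ℝ} {P a pv pt : ℕ → ℕ} {J j e : ℕ} {Q : Finset ℕ}
  {near : ℕ → ℝ}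

theorem near_le_of_card_lt (h : I.Cover T r) (hT : Traversal I P j near) (hj : I.k ≤ j) :
    near (P j) ≤ 2 * r := by
  by_contra! hlt
  have hle : #(range (j + 1)) ≤ #T := by
    refine card_le_card_of_separated (P := P) (r := r)
      (fun l hl => hT.pivot_lt l (Nat.le_of_lt_succ (mem_range.1 hl))) h.lt ?_
      fun l hl => h.cover _ (hT.pivot_lt l (Nat.le_of_lt_succ (mem_range.1 hl)))
    intro l hl l' hl' hne
    simp only [coe_range, Set.mem_Iio, Nat.lt_succ_iff] at hl hl'
    exact hlt.trans_le (hT.separated hl hl' hne)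
  rw [card_range, h.card_eq] at hle
  omega

theorem card_filter_lt (h : I.Cover T r) (hfull : ∀ i ∈ Q, I.quo i ≤ load a J i)
    (hover : ∃ i ∈ Q, I.quo i < load a J i) :
    #{t ∈ T | I.col t ∈ Q} < #{l ∈ range J | a l ∈ Q} := by
  rw [h.card_filter_mem, ← sum_load]
  exact sum_lt_sum hfull hover

theorem exists_col_not_mem (h : I.Cover T r)
    (hcard : #{t ∈ T | I.col t ∈ Q} < #{l ∈ range J | a l ∈ Q}) (hJ : J ≤ I.k) :
    ∃ u < I.n, I.col u ∉ Q := by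
  by_contra! hQ
  rw [filter_true_of_mem fun t ht => hQ t (h.lt t ht), h.card_eq] at hcard
  have := (card_filter_le (range J) fun l => a l ∈ Q).trans (card_range J).le
  omega

/-- The pigeonhole step: the overfull classes cannot serve all their pivots, because no center is
near two separated pivots. -/
theorem exists_near_col_not_mem (h : I.Cover T r)
    (hcard : #{t ∈ T | I.col t ∈ Q} < #{l ∈ range J | a l ∈ Q}) (hP : ∀ l < J, P l < I.n)
    (hsep : (Set.Iio J).Pairwise fun l l' => 2 * r < I.oracle (P l) (P l')) :
    ∃ l < J, a l ∈ Q ∧ ∃ u < I.n, I.oracle (P l) u ≤ r ∧ I.col u ∉ Q := by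
  by_contra! hnone
  refine hcard.not_ge (card_le_card_of_separated (I := I) (P := P) (r := r) ?_ ?_ ?_ ?_)
  · exact fun l hl => hP l (mem_range.1 (mem_filter.1 hl).1)
  · exact fun t ht => h.lt t (mem_filter.1 ht).1
  · exact hsep.mono fun l hl => by simpa using (mem_filter.1 hl).1
  · intro l hl
    obtain ⟨hlJ, hlQ⟩ := mem_filter.1 hl
    obtain ⟨t, ht, hle⟩ := h.cover (P l) (hP l (mem_range.1 hlJ))
    exact ⟨t, mem_filter.2 ⟨ht, hnone l (mem_range.1 hlJ) hlQ t (h.lt t ht) hle⟩, hle⟩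

theorem exists_leaves (h : I.Cover T r) (hE : EdgeTable I P j I.n pv pt)
    (hcard : #{t ∈ T | I.col t ∈ Q} < #{l ∈ range (j + 1) | a l ∈ Q}) (hj : j < I.k)
    (ha : a j ∈ Q) : ∃ e < j * I.m + I.m, Leaves I.col a pv pt Q e := by
  obtain ⟨u, hu, hcol⟩ := h.exists_col_not_mem hcard hj
  have hpt := (hE.nearest j u hu (.inr ⟨rfl, hu⟩)).1
  obtain ⟨hpv, hcol'⟩ := hE.eq_of_index hu hpt
  exact ⟨_, EdgeTable.index_lt le_rfl hu, hpt, by rwa [hpv], by rwa [hcol']⟩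

theorem edgeLength_le_of_shortest (h : I.Cover T r) (hE : EdgeTable I P j I.n pv pt)
    (hcard : #{t ∈ T | I.col t ∈ Q} < #{l ∈ range (j + 1) | a l ∈ Q}) (hP : ∀ l ≤ j, P l < I.n)
    (hsep : (Set.Iic j).Pairwise fun l l' => 2 * r < I.oracle (P l) (P l'))
    (hmin : ∀ e' < j * I.m + I.m, Leaves I.col a pv pt Q e' →
      edgeLength I P pv pt e ≤ edgeLength I P pv pt e') :
    edgeLength I P pv pt e ≤ r := by
  obtain ⟨l, hl, hlQ, u, hu, hle, hcol⟩ := h.exists_near_col_not_mem hcard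
    (fun l hl => hP l (Nat.le_of_lt_succ hl))
    (hsep.mono fun l hl => Nat.le_of_lt_succ hl)
  obtain ⟨hpt, hnear⟩ := hE.nearest l u hu
    ((Nat.lt_succ_iff_lt_or_eq.1 hl).imp_right fun h => ⟨h, hu⟩)
  obtain ⟨hpv, hcol'⟩ := hE.eq_of_index hu hpt
  refine (hmin _ (EdgeTable.index_lt (Nat.le_of_lt_succ hl) hu)
    ⟨hpt, by rwa [hpv], by rwa [hcol']⟩).trans (le_trans ?_ hle)
  rwa [edgeLength, hpv]

theorem near_le_of_long_shortest (h : I.Cover T r) (hT : Traversal I P j near)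
    (hE : EdgeTable I P j I.n pv pt)
    (hcard : #{t ∈ T | I.col t ∈ Q} < #{l ∈ range (j + 1) | a l ∈ Q})
    (hmin : ∀ e' < j * I.m + I.m, Leaves I.col a pv pt Q e' →
      edgeLength I P pv pt e ≤ edgeLength I P pv pt e')
    (hlong : near (P j) < edgeLength I P pv pt e + edgeLength I P pv pt e) :
    near (P j) ≤ 2 * r := by
  by_contra! hlt
  have := h.edgeLength_le_of_shortest hE hcard hT.pivot_lt
    (hT.separated.imp fun _ _ hle => hlt.trans_le hle) hmin
  linarith

theorem edgeLength_le_of_short_shortest (h : I.Cover T r) (hT : Traversal I P j near)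
    (hE : EdgeTable I P j I.n pv pt)
    (hcard : #{t ∈ T | I.col t ∈ Q} < #{l ∈ range (j + 1) | a l ∈ Q})
    (hmin : ∀ e' < j * I.m + I.m, Leaves I.col a pv pt Q e' →
      edgeLength I P pv pt e ≤ edgeLength I P pv pt e')
    (hshort : j ≠ 0 → edgeLength I P pv pt e + edgeLength I P pv pt e ≤ near (P j)) :
    edgeLength I P pv pt e ≤ r := by
  by_cases hsep : j = 0 ∨ 2 * r < near (P j)
  · refine h.edgeLength_le_of_shortest hE hcard hT.pivot_lt (fun l hl l' hl' hne => ?_) hmin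
    rcases hsep with rfl | hlt
    · simp only [Set.mem_Iic, Nat.le_zero] at hl hl'
      omega
    · exact hlt.trans_le (hT.separated hl hl' hne)
  · push Not at hsep
    linarith [hshort hsep.1]

end Problem.Cover

namespace Reg

abbrev numPoints : ℕ := 0
abbrev numClasses : ℕ := 1
abbrev numCenters : ℕ := 2
abbrev matched : ℕ := 3
abbrev rowStart : ℕ := 4
abbrev idx : ℕ := 5
abbrev edge : ℕ := 6
abbrev bestEdge : ℕ := 7
abbrev hasBest : ℕ := 8
abbrev clock : ℕ := 9
abbrev status : ℕ := 10
abbrev hole : ℕ := 11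
abbrev moved : ℕ := 12
abbrev nextHole : ℕ := 13
abbrev farthest : ℕ := 14
abbrev candidate : ℕ := 15
abbrev outSize : ℕ := 16

end Reg

namespace Arr

abbrev classOf : ℕ := 0
abbrev quota : ℕ := 1
abbrev output : ℕ := 2
abbrev pivot : ℕ := 3
abbrev edgePivot : ℕ := 4
abbrev edgePoint : ℕ := 5
abbrev assigned : ℕ := 6
abbrev center : ℕ := 7
abbrev load : ℕ := 8
abbrev reachTime : ℕ := 9
abbrev reachEdge : ℕ := 10
abbrev chosen : ℕ := 11
abbrev chosenCount : ℕ := 12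

end Arr

namespace RArr

abbrev near : ℕ := 0

end RArr

open Prog

attribute [local simp] Prog.final Prog.LoopFree NExp.eval BExp.eval RExp.eval

/-- The input of the instance `I` is still in memory. -/
structure HasInput (I : Problem) (s : State) : Prop where
  numPoints : s.nreg Reg.numPoints = I.n
  numClasses : s.nreg Reg.numClasses = I.m
  numCenters : s.nreg Reg.numCenters = I.k
  classOf : s.narr Arr.classOf = I.col
  quota : s.narr Arr.quota = I.quo

/-- Point `w` is within `r` of pivot `l`. -/
def Near (I : Problem) (P : ℕ → ℕ) (r : ℝ) (l w : ℕ) : Prop := w < I.n ∧ I.oracle (P l) w ≤ r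

/-- The first `j` pivots are assigned to classes, respecting the quotas, and their centers, which
are points of these classes, are within `r` of them. -/
structure Assignment (I : Problem) (r : ℝ) (j : ℕ) (s : State) : Prop where
  load_eq : ∀ c, s.narr Arr.load c = load (s.narr Arr.assigned) j c
  load_le : ∀ c, s.narr Arr.load c ≤ I.quo c
  center : ∀ l < j, s.narr Arr.assigned l < I.m ∧
    I.col (s.narr Arr.center l) = s.narr Arr.assigned l ∧
    Near I (s.narr Arr.pivot) r l (s.narr Arr.center l)

/-- The state between two rounds of the algorithm: the first `j` pivots have been assigned, and
pivot `j` is already known. -/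
structure Matching (I : Problem) (r : ℝ) (j : ℕ) (s : State) : Prop extends
    Assignment I r j s where
  input : HasInput I s
  matched : s.nreg Reg.matched = j
  rowStart : s.nreg Reg.rowStart = j * I.m
  traversal : Traversal I (s.narr Arr.pivot) j (s.rarr RArr.near)

/-- The edge table in memory. -/
def Edges (I : Problem) (j i : ℕ) (s : State) : Prop :=
  EdgeTable I (s.narr Arr.pivot) j i (s.narr Arr.edgePivot) (s.narr Arr.edgePoint)

/-- The length of an edge in memory. -/
noncomputable def State.edgeLength (I : Problem) (s : State) : ℕ → ℝ :=
  FairKCenter.edgeLength I (s.narr Arr.pivot) (s.narr Arr.edgePivot) (s.narr Arr.edgePoint)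

/-- An edge in memory leaves the classes reached by the search. -/
def State.Leaves (I : Problem) (s : State) : ℕ → Prop :=
  FairKCenter.Leaves I.col (s.narr Arr.assigned) (s.narr Arr.edgePivot) (s.narr Arr.edgePoint)
    (reached I.m (s.narr Arr.reachTime))

section

variable {I : Problem} {r : ℝ} {i j : ℕ} {s s' : State} {W : List Loc}

theorem HasInput.of_eqOff (h : HasInput I s) (hs : EqOff W s s')
    (hW : ∀ l ∈ [Loc.nreg Reg.numPoints, .nreg Reg.numClasses, .nreg Reg.numCenters,
      .narr Arr.classOf, .narr Arr.quota], l ∉ W := by decide) : HasInput I s' where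
  numPoints := (hs.nreg _ (hW _ (by decide))).trans h.numPoints
  numClasses := (hs.nreg _ (hW _ (by decide))).trans h.numClasses
  numCenters := (hs.nreg _ (hW _ (by decide))).trans h.numCenters
  classOf := (hs.narr _ (hW _ (by decide))).trans h.classOf
  quota := (hs.narr _ (hW _ (by decide))).trans h.quota

theorem State.Leaves.of_eqOff {e : ℕ} (h : s.Leaves I e) (hs : EqOff W s s')
    (hW : ∀ l ∈ [Loc.narr Arr.assigned, .narr Arr.edgePivot, .narr Arr.edgePoint,
      .narr Arr.reachTime], l ∉ W := by decide) : s'.Leaves I e := by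
  rw [State.Leaves, hs.narr Arr.assigned (hW _ (by decide)),
    hs.narr Arr.edgePivot (hW _ (by decide)), hs.narr Arr.edgePoint (hW _ (by decide)),
    hs.narr Arr.reachTime (hW _ (by decide))]
  exact h

theorem load_congr {a b : ℕ → ℕ} {J : ℕ} (h : ∀ l < J, a l = b l) : load a J = load b J :=
  funext fun c => congrArg card (filter_congr fun l hl => by rw [h l (mem_range.1 hl)])

theorem Matching.of_eqOff (h : Matching I r j s) (hs : EqOff W s s')
    (ha : ∀ l < j, s'.narr Arr.assigned l = s.narr Arr.assigned l)
    (hW : ∀ l ∈ [Loc.nreg Reg.numPoints, .nreg Reg.numClasses, .nreg Reg.numCenters,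
      .narr Arr.classOf, .narr Arr.quota, .nreg Reg.matched, .nreg Reg.rowStart, .narr Arr.pivot,
      .narr Arr.load, .narr Arr.center, .rarr RArr.near], l ∉ W := by decide) :
    Matching I r j s' where
  input := h.input.of_eqOff hs fun l hl => hW l (by revert l; decide)
  matched := (hs.nreg _ (hW _ (by decide))).trans h.matched
  rowStart := (hs.nreg _ (hW _ (by decide))).trans h.rowStart
  traversal := by
    rw [hs.narr Arr.pivot (hW _ (by decide)), hs.rarr RArr.near (hW _ (by decide))]
    exact h.traversal
  load_eq c := by
    rw [hs.narr Arr.load (hW _ (by decide)), load_congr ha, h.load_eq]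
  load_le := by
    rw [hs.narr Arr.load (hW _ (by decide))]
    exact h.load_le
  center l hl := by
    rw [hs.narr Arr.center (hW _ (by decide)), hs.narr Arr.pivot (hW _ (by decide)), ha l hl]
    exact h.center l hl

theorem Edges.of_eqOff (h : Edges I j i s) (hs : EqOff W s s')
    (hW : ∀ l ∈ [Loc.narr Arr.pivot, .narr Arr.edgePivot, .narr Arr.edgePoint], l ∉ W
      := by decide) : Edges I j i s' := by
  rw [Edges, hs.narr Arr.pivot (hW _ (by decide)), hs.narr Arr.edgePivot (hW _ (by decide)),
    hs.narr Arr.edgePoint (hW _ (by decide))]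
  exact h

end

/-! ### The edge table -/

/-- The point to which the edge in register `e` leads. -/
def edgeTarget (e : ℕ) : NExp := .sub (.arr Arr.edgePoint (.reg e)) (.const 1)

/-- The length of the edge in register `e`. -/
def edgeDist (e : ℕ) : RExp := .dist (.arr Arr.pivot (.arr Arr.edgePivot (.reg e))) (edgeTarget e)

attribute [local simp] edgeTarget edgeDist

/-- Offer point `idx` to pivot `matched` as the end of an edge. -/
def offerPoint : Prog :=
  seq (nset Reg.edge (.add (.reg Reg.rowStart) (.arr Arr.classOf (.reg Reg.idx)))) <|
  ite (.and (.nle (.const 1) (.arr Arr.edgePoint (.reg Reg.edge)))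
      (.rle (edgeDist Reg.edge) (.dist (.arr Arr.pivot (.reg Reg.matched)) (.reg Reg.idx))))
    skip
    (seq (nstore Arr.edgePoint (.reg Reg.edge) (.add (.reg Reg.idx) (.const 1))) <|
     nstore Arr.edgePivot (.reg Reg.edge) (.reg Reg.matched))

/-- Compute the edges for the new pivot. -/
def fillRow : Prog := forTo Reg.idx (.reg Reg.numPoints) offerPoint

section

variable {I : Problem} {r : ℝ} {i j : ℕ} {s : State}

theorem offerPoint_haltsWithin (hI : HasInput I s) (hj : s.nreg Reg.matched = j)
    (hrow : s.nreg Reg.rowStart = j * I.m) (hidx : s.nreg Reg.idx = i) (hi : i < I.n)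
    (hE : Edges I j i s) : HaltsWithin I.oracle offerPoint s 31 (Edges I j (i + 1)) := by
  refine .of_loopFree (by simp [offerPoint]) (by decide) ?_
  set e := j * I.m + I.col i with he
  by_cases hold : s.narr Arr.edgePoint e ≠ 0 ∧ s.edgeLength I e ≤ I.oracle (s.narr Arr.pivot j) i
  · have hskip := hE.skip hi hold.1 hold.2
    rw [← Nat.one_le_iff_ne_zero, State.edgeLength, edgeLength] at hold
    simpa [Edges, offerPoint, hj, hrow, hidx, hI.classOf, ← he, hold] using hskip
  · have hinsert := hE.insert hi fun h0 => not_le.1 fun hle => hold ⟨h0, hle⟩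
    rw [← Nat.one_le_iff_ne_zero, State.edgeLength, edgeLength] at hold
    simpa [Edges, offerPoint, hj, hrow, hidx, hI.classOf, ← he, hold] using hinsert

theorem fillRow_haltsWithin (h : Matching I r j s) (hE : Edges I j 0 s) :
    HaltsWithin I.oracle fillRow s (60 * I.n + 60) (Edges I j I.n) := by
  refine (HaltsWithin.forTo I.n (Edges I j) (by decide) (fun s' hs => ?_) (fun _ _ _ h => h) hE
    fun i s' hs hi hidx hE' => offerPoint_haltsWithin (h.input.of_eqOff hs) ?_ ?_ hidx hi hE').mono
    ?_ fun _ _ h => h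
  · exact (hs.nreg _).trans h.input.numPoints
  · exact (hs.nreg _).trans h.matched
  · exact (hs.nreg _).trans h.rowStart
  · simp only [NExp.cost]
    omega

end

/-! ### Searching for an augmenting path -/

/-- The clock of the search for a class for the new pivot starts at the dummy class. -/
def startSearch : Prog :=
  seq (forTo Reg.idx (.reg Reg.numClasses) (nstore Arr.reachTime (.reg Reg.idx) (.const 0))) <|
  seq (nstore Arr.assigned (.reg Reg.matched) (.reg Reg.numClasses)) <|
  seq (nstore Arr.reachTime (.reg Reg.numClasses) (.const 1)) <|
  seq (nset Reg.clock (.const 1)) <|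
  nset Reg.status (.const 0)

/-- The class to which the edge in register `e` leads. -/
def edgeClass (e : ℕ) : NExp := .arr Arr.classOf (edgeTarget e)

/-- The edge in register `edge` leaves the reached classes. -/
def edgeLeaves : BExp :=
  .and (.nle (.const 1) (.arr Arr.edgePoint (.reg Reg.edge)))
    (.and (.nle (.const 1) (.arr Arr.reachTime (.arr Arr.assigned
        (.arr Arr.edgePivot (.reg Reg.edge)))))
      (.nle (.arr Arr.reachTime (edgeClass Reg.edge)) (.const 0)))

/-- The edge in register `edge` leaves the reached classes and is shorter than the best such edge
found so far. -/
def improvesBest : BExp :=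
  .and edgeLeaves (.not (.and (.nle (.const 1) (.reg Reg.hasBest))
    (.rle (edgeDist Reg.bestEdge) (edgeDist Reg.edge))))

/-- Improve the best edge found so far. -/
def scanStep : Prog :=
  ite improvesBest (seq (nset Reg.bestEdge (.reg Reg.edge)) (nset Reg.hasBest (.const 1))) skip

/-- Find a shortest edge that leaves the reached classes. -/
def scanEdges : Prog :=
  seq (nset Reg.hasBest (.const 0)) <|
  forTo Reg.edge (.add (.reg Reg.rowStart) (.reg Reg.numClasses)) scanStep

attribute [local simp] edgeClass edgeLeaves

section

variable {I : Problem} {r : ℝ} {j : ℕ} {s : State}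

theorem startSearch_haltsWithin (hI : HasInput I s) (hj : s.nreg Reg.matched = j) :
    HaltsWithin I.oracle startSearch s (20 * I.m + 20) fun s' =>
      s'.narr Arr.assigned = Function.update (s.narr Arr.assigned) j I.m ∧
      s'.narr Arr.reachTime I.m = 1 ∧ (∀ i < I.m, s'.narr Arr.reachTime i = 0) ∧
      s'.nreg Reg.clock = 1 ∧ s'.nreg Reg.status = 0 := by
  refine ((HaltsWithin.forTo (T := 3) I.m (fun i s' => ∀ c < i, s'.narr Arr.reachTime c = 0)
    (by decide) (fun s' hs => ?_) (fun _ _ _ h => h) (by simp) fun i s' _ _ hidx h => ?_).seq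
    fun s' hs h => .of_loopFree (T := 12) (by simp) (by decide) ?_).mono ?_ fun _ _ h => h
  · exact (hs.nreg _).trans hI.numClasses
  · refine .of_loopFree (by simp) (by decide) fun c hc => ?_
    simp only [final, NExp.eval, hidx, Function.update_self, Function.update_apply]
    split_ifs with hci
    · rfl
    · exact h c (by omega)
  · have hj' := (hs.nreg Reg.matched).trans hj
    have ha' := hs.narr Arr.assigned
    have hm' := (hs.nreg Reg.numClasses).trans hI.numClasses
    simpa [hj', ha', hm'] using fun i hi => (Function.update_of_ne hi.ne _ _).trans (h i hi)
  · simp only [NExp.cost]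
    omega

/-- If an edge below `i` leaves the reached classes, then `bestEdge` is a shortest one. -/
def BestBelow (I : Problem) (i : ℕ) (s : State) : Prop :=
  (s.nreg Reg.hasBest = 0 ∧ ∀ e < i, ¬ s.Leaves I e) ∨
    (s.nreg Reg.hasBest = 1 ∧ s.Leaves I (s.nreg Reg.bestEdge) ∧
      ∀ e < i, s.Leaves I e → s.edgeLength I (s.nreg Reg.bestEdge) ≤ s.edgeLength I e)

theorem edgeLeaves_eval (hI : HasInput I s) (hE : Edges I j I.n s)
    (ha : ∀ l ≤ j, s.narr Arr.assigned l ≤ I.m) :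
    edgeLeaves.eval I.oracle s ↔ s.Leaves I (s.nreg Reg.edge) := by
  set e := s.nreg Reg.edge with he
  rw [State.Leaves, Leaves]
  by_cases hpt : s.narr Arr.edgePoint e = 0
  · simp [← he, hpt]
  · have hle := ha _ (hE.sound _ hpt).1
    have hcol := (Problem.col_lt (hE.pred_lt hpt)).le
    simp [mem_reached, hle, hcol, ← he, hI.classOf, hpt, Nat.one_le_iff_ne_zero]

theorem scanStep_haltsWithin {i : ℕ} (hedge : s.nreg Reg.edge = i)
    (hL : edgeLeaves.eval I.oracle s ↔ s.Leaves I i) (h : BestBelow I i s) :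
    HaltsWithin I.oracle scanStep s 47 (BestBelow I (i + 1)) := by
  refine .of_loopFree (by simp [scanStep]) (by decide) ?_
  have htest : improvesBest.eval I.oracle s ↔ s.Leaves I i ∧
      ¬ (1 ≤ s.nreg Reg.hasBest ∧ s.edgeLength I (s.nreg Reg.bestEdge) ≤ s.edgeLength I i) :=
    and_congr hL (hedge ▸ Iff.rfl)
  by_cases hbetter : improvesBest.eval I.oracle s
  · have hfinal : scanStep.final I.oracle s = (s.setReg Reg.bestEdge i).setReg Reg.hasBest 1 := by
      simp only [scanStep, final, if_pos hbetter, NExp.eval, hedge]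
      rfl
    rw [hfinal]
    rw [htest] at hbetter
    refine .inr ⟨rfl, hbetter.1, fun e he (hLe : s.Leaves I e) => ?_⟩
    change s.edgeLength I i ≤ s.edgeLength I e
    grind [BestBelow]
  · have hfinal : scanStep.final I.oracle s = s := by
      simp only [scanStep, final, if_neg hbetter]
    rw [hfinal]
    grind [BestBelow]

theorem scanEdges_haltsWithin (hI : HasInput I s) (hrow : s.nreg Reg.rowStart = j * I.m)
    (hE : Edges I j I.n s) (ha : ∀ l ≤ j, s.narr Arr.assigned l ≤ I.m)
    (hex : ∃ e < j * I.m + I.m, s.Leaves I e) :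
    HaltsWithin I.oracle scanEdges s (60 * (j * I.m + I.m) + 60) fun s' =>
      s'.Leaves I (s'.nreg Reg.bestEdge) ∧ ∀ e < j * I.m + I.m, s'.Leaves I e →
        s'.edgeLength I (s'.nreg Reg.bestEdge) ≤ s'.edgeLength I e := by
  have init : HaltsWithin I.oracle (nset Reg.hasBest (.const 0)) s 2 (BestBelow I 0) :=
    .of_loopFree (by simp) (by decide) (.inl ⟨by simp, by simp⟩)
  refine (init.seq fun s₁ hs₁ h₁ => .forTo (x := Reg.edge) (j * I.m + I.m) (BestBelow I) (by decide)
    (fun s₂ hs₂ => ?_) (fun _ _ _ h => h) h₁ fun i s₂ hs₂ _ hedge h₂ =>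
      scanStep_haltsWithin hedge ?_ h₂).mono ?_ fun s' hs' h => ?_
  · simp [hs₂.nreg Reg.rowStart, hs₁.nreg Reg.rowStart, hrow,
      ((hI.of_eqOff hs₁).of_eqOff hs₂).numClasses]
  · have hE₂ := (hE.of_eqOff hs₁).of_eqOff hs₂
    rw [edgeLeaves_eval ((hI.of_eqOff hs₁).of_eqOff hs₂) hE₂, hedge]
    rwa [hs₂.narr Arr.assigned, hs₁.narr Arr.assigned]
  · simp only [NExp.cost]
    omega
  · refine (h.resolve_left fun ⟨_, hnone⟩ => ?_).2
    obtain ⟨e, he, hLe⟩ := hex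
    exact hnone e he (hLe.of_eqOff hs')

end

/-- The search has been started from pivot `matched`, which is assigned to the dummy class `m`.
Status `0`: it is still running, and all classes reached so far are full. Status `1`: class `hole`
has been reached and is not full. Status `2`: the first `matched` pivots cover all points within
`2 * r`. -/
structure Searching (I : Problem) (r : ℝ) (j : ℕ) (s : State) : Prop where
  matching : Matching I r j s
  edges : Edges I j I.n s
  dummy : s.narr Arr.assigned j = I.m
  inv : SearchInv I.col (Near I (s.narr Arr.pivot) r) I.m (j + 1) (s.narr Arr.assigned)
    (s.narr Arr.edgePivot) (s.narr Arr.edgePoint) (s.narr Arr.reachTime) (s.narr Arr.reachEdge)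
    (s.nreg Reg.clock)
  outcome : (s.nreg Reg.status = 0 ∧
      ∀ c ∈ reached I.m (s.narr Arr.reachTime), I.quo c ≤ s.narr Arr.load c) ∨
    (s.nreg Reg.status = 1 ∧ s.nreg Reg.hole < I.m ∧
      s.narr Arr.reachTime (s.nreg Reg.hole) ≠ 0 ∧
      s.narr Arr.load (s.nreg Reg.hole) < I.quo (s.nreg Reg.hole)) ∨
    (s.nreg Reg.status = 2 ∧ j ≠ 0 ∧ s.rarr RArr.near (s.narr Arr.pivot j) ≤ 2 * r)

namespace Searching

variable {I : Problem} {r : ℝ} {j : ℕ} {s : State}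

theorem assigned_le (h : Searching I r j s) {l : ℕ} (hl : l ≤ j) :
    s.narr Arr.assigned l ≤ I.m := by
  rcases hl.lt_or_eq with hl | rfl
  · exact (h.matching.center l hl).1.le
  · exact h.dummy.le

theorem of_eqOff {W : List Loc} {s' : State} (h : Searching I r j s) (hs : EqOff W s s')
    (hW : ∀ l ∈ [Loc.nreg Reg.numPoints, .nreg Reg.numClasses, .nreg Reg.numCenters,
      .narr Arr.classOf, .narr Arr.quota, .nreg Reg.matched, .nreg Reg.rowStart, .narr Arr.pivot,
      .narr Arr.load, .narr Arr.center, .rarr RArr.near, .narr Arr.edgePivot, .narr Arr.edgePoint,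
      .narr Arr.assigned, .narr Arr.reachTime, .narr Arr.reachEdge, .nreg Reg.clock,
      .nreg Reg.status, .nreg Reg.hole], l ∉ W := by decide) : Searching I r j s' where
  matching := h.matching.of_eqOff hs (fun l _ => congrFun (hs.narr _ (hW _ (by decide))) l)
    fun l hl => hW l (by revert l; decide)
  edges := h.edges.of_eqOff hs fun l hl => hW l (by revert l; decide)
  dummy := (congrFun (hs.narr _ (hW _ (by decide))) j).trans h.dummy
  inv := by
    rw [hs.narr Arr.pivot (hW _ (by decide)), hs.narr Arr.assigned (hW _ (by decide)),
      hs.narr Arr.edgePivot (hW _ (by decide)), hs.narr Arr.edgePoint (hW _ (by decide)),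
      hs.narr Arr.reachTime (hW _ (by decide)), hs.narr Arr.reachEdge (hW _ (by decide)),
      hs.nreg Reg.clock (hW _ (by decide))]
    exact h.inv
  outcome := by
    rw [hs.nreg Reg.status (hW _ (by decide)), hs.nreg Reg.hole (hW _ (by decide)),
      hs.narr Arr.reachTime (hW _ (by decide)), hs.narr Arr.load (hW _ (by decide)),
      hs.narr Arr.pivot (hW _ (by decide)), hs.rarr RArr.near (hW _ (by decide))]
    exact h.outcome

theorem load_succ (h : Searching I r j s) (c : ℕ) :
    load (s.narr Arr.assigned) (j + 1) c = s.narr Arr.load c + if c = I.m then 1 else 0 := by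
  have := load_update_succ (s.narr Arr.assigned) j I.m c
  rwa [← h.dummy, Function.update_eq_self, h.dummy, ← h.matching.load_eq] at this

theorem card_lt (h : Searching I r j s) {T : Finset ℕ} (hT : I.Cover T r)
    (hfull : ∀ c ∈ reached I.m (s.narr Arr.reachTime), I.quo c ≤ s.narr Arr.load c) :
    #{t ∈ T | I.col t ∈ reached I.m (s.narr Arr.reachTime)} <
      #{l ∈ range (j + 1) | s.narr Arr.assigned l ∈ reached I.m (s.narr Arr.reachTime)} := by
  refine hT.card_filter_lt (fun c hc => ?_) ⟨I.m, mem_reached.2 ⟨le_rfl, h.inv.root⟩, ?_⟩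
  · rw [h.load_succ]
    exact (hfull c hc).trans (Nat.le_add_right _ _)
  · rw [h.load_succ, if_pos rfl, Problem.quo_of_le le_rfl]
    omega

end Searching

/-- More than half of the distance from pivot `matched` to the other ones is needed to leave the
reached classes. -/
def bestTooLong : BExp :=
  .and (.nle (.const 1) (.reg Reg.matched))
    (.not (.rle (.add (edgeDist Reg.bestEdge) (edgeDist Reg.bestEdge))
      (.arr RArr.near (.arr Arr.pivot (.reg Reg.matched)))))

/-- Reach a class along the edge `bestEdge`. -/
def reachClass : Prog :=
  seq (nset Reg.hole (edgeClass Reg.bestEdge)) <|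
  seq (nstore Arr.reachEdge (.reg Reg.hole) (.reg Reg.bestEdge)) <|
  seq (nset Reg.clock (.add (.reg Reg.clock) (.const 1))) <|
  seq (nstore Arr.reachTime (.reg Reg.hole) (.reg Reg.clock)) <|
  ite (.nle (.add (.arr Arr.load (.reg Reg.hole)) (.const 1)) (.arr Arr.quota (.reg Reg.hole)))
    (nset Reg.status (.const 1)) skip

/-- Extend the search by a shortest edge, unless it is too long. -/
def searchStep : Prog :=
  seq scanEdges (ite bestTooLong (nset Reg.status (.const 2)) reachClass)

/-- Search for a class that is not full. -/
def search : Prog := loop (.nle (.reg Reg.status) (.const 0)) searchStep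

section

variable {I : Problem} {r : ℝ} {j : ℕ} {s : State} {T : Finset ℕ}

theorem reachClass_haltsWithin (h : Searching I r j s) (hstatus : s.nreg Reg.status = 0)
    (hfull : ∀ c ∈ reached I.m (s.narr Arr.reachTime), I.quo c ≤ s.narr Arr.load c)
    (hL : s.Leaves I (s.nreg Reg.bestEdge)) (hle : s.edgeLength I (s.nreg Reg.bestEdge) ≤ r) :
    HaltsWithin I.oracle reachClass s 30 fun s' =>
      Searching I r j s' ∧ s'.nreg Reg.clock = s.nreg Reg.clock + 1 := by
  set e := s.nreg Reg.bestEdge with he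
  set c := I.col (s.narr Arr.edgePoint e - 1) with hc
  have final : HaltsWithin I.oracle reachClass s 30 fun s' =>
      s'.nreg Reg.hole = c ∧ s'.nreg Reg.clock = s.nreg Reg.clock + 1 ∧
      s'.narr Arr.reachTime = Function.update (s.narr Arr.reachTime) c (s.nreg Reg.clock + 1) ∧
      s'.narr Arr.reachEdge = Function.update (s.narr Arr.reachEdge) c e ∧
      (s'.nreg Reg.status = 1 ∧ s.narr Arr.load c < I.quo c ∨
        s'.nreg Reg.status = 0 ∧ I.quo c ≤ s.narr Arr.load c) := by
    refine .of_loopFree (by simp [reachClass]) (by decide) ?_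
    by_cases hroom : s.narr Arr.load c + 1 ≤ I.quo c
    · simpa [reachClass, ← he, h.matching.input.classOf, ← hc, h.matching.input.quota, hroom]
        using Nat.lt_of_succ_le hroom
    · simpa [reachClass, ← he, h.matching.input.classOf, ← hc, h.matching.input.quota, hroom,
        hstatus] using Nat.le_of_lt_succ (not_le.1 hroom)
  have hv := h.edges.pred_lt hL.1
  have hcm : c < I.m := Problem.col_lt hv
  have hinv := h.inv.extend hL hcm (Nat.lt_succ_of_le (h.edges.sound e hL.1).1) ⟨hv, hle⟩
  refine final.mono le_rfl fun s' hs ⟨hhole, hclock, htime, hvia, hst⟩ =>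
    ⟨⟨?_, ?_, ?_, ?_, ?_⟩, hclock⟩
  · exact h.matching.of_eqOff hs fun l _ => congrFun (hs.narr _) l
  · exact h.edges.of_eqOff hs
  · rw [hs.narr Arr.assigned, h.dummy]
  · rwa [hclock, htime, hvia, hs.narr Arr.pivot, hs.narr Arr.assigned, hs.narr Arr.edgePivot,
      hs.narr Arr.edgePoint]
  · rw [hs.narr Arr.load, hhole, htime, SearchInv.reached_update hcm, Function.update_self]
    exact hst.symm.imp (fun ⟨hst, hle⟩ => ⟨hst, forall_mem_insert _ _ _ |>.2 ⟨hle, hfull⟩⟩)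
      fun ⟨hst, hlt⟩ => .inl ⟨hst, hcm, Nat.succ_ne_zero _, hlt⟩

theorem giveUp_haltsWithin (h : Searching I r j s) (hj : j ≠ 0)
    (hnear : s.rarr RArr.near (s.narr Arr.pivot j) ≤ 2 * r) :
    HaltsWithin I.oracle (nset Reg.status (.const 2)) s 2 fun s' =>
      Searching I r j s' ∧ s'.nreg Reg.status = 2 := by
  refine (HaltsWithin.of_loopFree (R := fun s' => s'.nreg Reg.status = 2) (by simp) (by decide)
    (by simp)).mono le_rfl fun s' hs hst => ⟨⟨?_, h.edges.of_eqOff hs, ?_, ?_, ?_⟩, hst⟩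
  · exact h.matching.of_eqOff hs fun l _ => congrFun (hs.narr _) l
  · exact (congrFun (hs.narr _) j).trans h.dummy
  · rw [hs.narr Arr.pivot, hs.narr Arr.assigned, hs.narr Arr.edgePivot, hs.narr Arr.edgePoint,
      hs.narr Arr.reachTime, hs.narr Arr.reachEdge, hs.nreg Reg.clock]
    exact h.inv
  · rw [hs.rarr RArr.near, hs.narr Arr.pivot]
    exact .inr (.inr ⟨hst, hj, hnear⟩)

theorem searchStep_haltsWithin (h : Searching I r j s) (hT : I.Cover T r) (hj : j < I.k)
    (hstatus : s.nreg Reg.status = 0) :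
    HaltsWithin I.oracle searchStep s (60 * (j * I.m + I.m) + 125) fun s' => Searching I r j s' ∧
      (s'.nreg Reg.status = 0 → s'.nreg Reg.clock = s.nreg Reg.clock + 1) := by
  have hfull := h.outcome.resolve_right (by omega) |>.2
  have hex := hT.exists_leaves h.edges (h.card_lt hT hfull) hj
    (h.dummy.symm ▸ mem_reached.2 ⟨le_rfl, h.inv.root⟩)
  refine ((scanEdges_haltsWithin h.matching.input h.matching.rowStart h.edges
    (fun _ => h.assigned_le) hex).seq fun s₁ hs₁ ⟨hL, hmin⟩ => ?_).mono
    (T := 60 * (j * I.m + I.m) + 60 + (BExp.cost bestTooLong + 30)) ?_ fun _ _ h => h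
  · have h₁ := h.of_eqOff hs₁
    have hstatus₁ := (hs₁.nreg Reg.status).trans hstatus
    have hfull₁ := h₁.outcome.resolve_right (by omega) |>.2
    have hcard := h₁.card_lt hT hfull₁
    have htest : bestTooLong.eval I.oracle s₁ ↔ 1 ≤ j ∧
        ¬ s₁.edgeLength I (s₁.nreg Reg.bestEdge) + s₁.edgeLength I (s₁.nreg Reg.bestEdge) ≤
          s₁.rarr RArr.near (s₁.narr Arr.pivot j) := h₁.matching.matched ▸ Iff.rfl
    refine .ite (fun hlong => ?_) fun hshort => ?_
    · obtain ⟨hj0, hlong⟩ := htest.1 hlong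
      refine (giveUp_haltsWithin h₁ (by omega) (hT.near_le_of_long_shortest h₁.matching.traversal
        h₁.edges hcard hmin (not_le.1 hlong))).mono (by omega) fun s' _ h' => ⟨h'.1, fun h0 => ?_⟩
      omega
    · rw [htest, not_and, not_not, Nat.one_le_iff_ne_zero] at hshort
      refine (reachClass_haltsWithin h₁ hstatus₁ hfull₁ hL (hT.edgeLength_le_of_short_shortest
        h₁.matching.traversal h₁.edges hcard hmin hshort)).mono le_rfl fun s' _ h' => ?_
      exact ⟨h'.1, fun _ => h'.2.trans (congrArg (· + 1) (hs₁.nreg _))⟩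
  · have : bestTooLong.cost ≤ 35 := by decide
    omega

theorem search_haltsWithin (h : Searching I r j s) (hT : I.Cover T r) (hj : j < I.k) :
    HaltsWithin I.oracle search s ((I.m + 2) * (60 * (j * I.m + I.m) + 128) + 3) fun s' =>
      Searching I r j s' ∧ s'.nreg Reg.status ≠ 0 := by
  refine (HaltsWithin.loop (T := 60 * (j * I.m + I.m) + 125) (Searching I r j)
    (fun s' => if s'.nreg Reg.status = 0 then I.m + 2 - s'.nreg Reg.clock else 0) h
    fun s₁ _ h₁ hb => ?_).mono ?_ fun s' _ h' => ⟨h'.1, by simpa using h'.2⟩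
  · have hstatus : s₁.nreg Reg.status = 0 := Nat.le_zero.1 hb
    refine (searchStep_haltsWithin h₁ hT hj hstatus).mono le_rfl fun s₂ _ ⟨h₂, hclock⟩ => ⟨h₂, ?_⟩
    have := h₁.inv.clock_le
    rw [if_pos hstatus]
    split_ifs with h0
    · have := hclock h0
      omega
    · omega
  · refine Nat.add_le_add_right (Nat.mul_le_mul ?_ ?_) 3
    · split_ifs <;> omega
    · simp only [BExp.cost, NExp.cost]
      omega

end

/-! ### Augmenting the assignment -/

/-- Move a pivot to the class `hole`, along the edge by which the search reached this class. -/
def fillHole : Prog :=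
  seq (nset Reg.edge (.arr Arr.reachEdge (.reg Reg.hole))) <|
  seq (nset Reg.moved (.arr Arr.edgePivot (.reg Reg.edge))) <|
  seq (nstore Arr.center (.reg Reg.moved) (edgeTarget Reg.edge)) <|
  seq (nset Reg.nextHole (.arr Arr.assigned (.reg Reg.moved))) <|
  seq (nstore Arr.assigned (.reg Reg.moved) (.reg Reg.hole)) <|
  nset Reg.hole (.reg Reg.nextHole)

/-- Move pivots until the hole is the dummy class. -/
def fillHoles : Prog := loop (.not (.nle (.reg Reg.numClasses) (.reg Reg.hole))) fillHole

/-- Move the pivots along an augmenting path that ends in class `hole`. -/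
def augment : Prog :=
  seq (nstore Arr.load (.reg Reg.hole) (.add (.arr Arr.load (.reg Reg.hole)) (.const 1))) fillHoles

section

variable {I : Problem} {r : ℝ} {j J : ℕ} {s : State} {G : ℕ → ℕ → Prop} {a₀ L : ℕ → ℕ}

theorem fillHole_haltsWithin
    (h : Augmenting I.col G I.m J (s.narr Arr.reachTime) a₀ L (s.narr Arr.assigned)
      (s.narr Arr.center) (s.nreg Reg.hole))
    (hT : SearchTree I.col G I.m J a₀ (s.narr Arr.edgePivot) (s.narr Arr.edgePoint)
      (s.narr Arr.reachTime) (s.narr Arr.reachEdge))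
    (hhole : s.nreg Reg.hole < I.m) :
    HaltsWithin I.oracle fillHole s 25 fun s' =>
      Augmenting I.col G I.m J (s.narr Arr.reachTime) a₀ L (s'.narr Arr.assigned)
        (s'.narr Arr.center) (s'.nreg Reg.hole) ∧
      s.narr Arr.reachTime (s'.nreg Reg.hole) < s.narr Arr.reachTime (s.nreg Reg.hole) :=
  .of_loopFree (by simp [fillHole]) (by decide) (by simpa [fillHole] using h.move hT hhole)

theorem fillHoles_haltsWithin (hI : HasInput I s)
    (h : Augmenting I.col G I.m J (s.narr Arr.reachTime) a₀ L (s.narr Arr.assigned)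
      (s.narr Arr.center) (s.nreg Reg.hole))
    (hT : SearchTree I.col G I.m J a₀ (s.narr Arr.edgePivot) (s.narr Arr.edgePoint)
      (s.narr Arr.reachTime) (s.narr Arr.reachEdge)) :
    HaltsWithin I.oracle fillHoles s (s.narr Arr.reachTime (s.nreg Reg.hole) * 29 + 4) fun s' =>
      Augmenting I.col G I.m J (s.narr Arr.reachTime) a₀ L (s'.narr Arr.assigned)
        (s'.narr Arr.center) (s'.nreg Reg.hole) ∧ I.m ≤ s'.nreg Reg.hole := by
  refine (HaltsWithin.loop (T := 25)
    (fun s' => Augmenting I.col G I.m J (s.narr Arr.reachTime) a₀ L (s'.narr Arr.assigned)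
      (s'.narr Arr.center) (s'.nreg Reg.hole))
    (fun s' => s.narr Arr.reachTime (s'.nreg Reg.hole)) h fun s₁ hs₁ h₁ hb => ?_).mono le_rfl
    fun s' hs' ⟨h', hb⟩ => ⟨h', ?_⟩
  · rw [← hs₁.narr Arr.reachTime] at h₁ ⊢
    refine fillHole_haltsWithin h₁ ?_ ?_
    · rwa [hs₁.narr Arr.reachTime, hs₁.narr Arr.edgePivot, hs₁.narr Arr.edgePoint,
        hs₁.narr Arr.reachEdge]
    · simpa [(hI.of_eqOff hs₁).numClasses] using hb
  · simpa [(hI.of_eqOff hs').numClasses] using hb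

theorem Searching.augmenting (h : Searching I r j s) {i : ℕ} (hi : i < I.m)
    (hne : s.narr Arr.reachTime i ≠ 0) :
    Augmenting I.col (Near I (s.narr Arr.pivot) r) I.m (j + 1) (s.narr Arr.reachTime)
      (s.narr Arr.assigned)
      (Function.update (s.narr Arr.load) i (s.narr Arr.load i + 1)) (s.narr Arr.assigned)
      (s.narr Arr.center) i where
  hole_le := hi.le
  hole_reached := hne
  assigned_le l hl := h.assigned_le (Nat.le_of_lt_succ hl)
  center l hl hlm := by
    have hlj : l ≠ j := fun hlj => hlm.ne (hlj ▸ h.dummy)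
    exact (h.matching.center l (by omega)).2
  load_eq c := by
    rw [h.load_succ, Function.update_apply]
    split_ifs <;> grind
  untouched _ _ := .inl rfl

theorem augment_haltsWithin (h : Searching I r j s) (hstatus : s.nreg Reg.status = 1) :
    HaltsWithin I.oracle augment s (29 * (I.m + 1) + 10) (Assignment I r (j + 1)) := by
  obtain ⟨-, hlt, hne, hroom⟩ := (h.outcome.resolve_left (by omega)).resolve_right (by omega)
  set i := s.nreg Reg.hole with hi
  set L := Function.update (s.narr Arr.load) i (s.narr Arr.load i + 1) with hL
  have init : HaltsWithin I.oracle
      (nstore Arr.load (.reg Reg.hole) (.add (.arr Arr.load (.reg Reg.hole)) (.const 1))) s 6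
      fun s' => s'.narr Arr.load = L := .of_loopFree (by simp) (by decide) (by simp [hL, hi])
  have htime : s.narr Arr.reachTime i ≤ I.m + 1 := (h.inv.le_clock i hlt.le).trans h.inv.clock_le
  have L_le (c : ℕ) : L c ≤ I.quo c := by
    rw [hL, Function.update_apply]
    split_ifs with hci
    · exact hci ▸ hroom
    · exact h.matching.load_le c
  refine (init.seq (T' := s.narr Arr.reachTime i * 29 + 4) fun s₁ hs₁ hL₁ => ?_).mono (by omega)
    fun _ _ h => h
  have haug := h.augmenting hlt hne
  have htree := h.inv.tree
  have hhole : s₁.nreg Reg.hole = i := hs₁.nreg _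
  rw [← hL, ← hhole, ← hs₁.narr Arr.reachTime, ← hs₁.narr Arr.assigned,
    ← hs₁.narr Arr.center] at haug
  rw [← hs₁.narr Arr.edgePivot, ← hs₁.narr Arr.edgePoint, ← hs₁.narr Arr.reachTime,
    ← hs₁.narr Arr.reachEdge, ← hs₁.narr Arr.assigned] at htree
  refine (fillHoles_haltsWithin (h.matching.input.of_eqOff hs₁) haug htree).mono ?_
    fun s' hs' ⟨haug', hend⟩ => ?_
  · rw [hs₁.narr Arr.reachTime, hhole]
  have hload : s'.narr Arr.load = L := (hs'.narr _).trans hL₁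
  have hpivot : s'.narr Arr.pivot = s.narr Arr.pivot := (hs'.narr _).trans (hs₁.narr _)
  refine ⟨fun c => ?_, hload ▸ L_le, fun l hl => ?_⟩
  · rw [hload, haug'.load_eq_of_le hend]
  · rw [hpivot]
    exact haug'.center_of_le hend (Nat.le_zero.1 ((L_le _).trans (Problem.quo_of_le le_rfl).le)) hl

end

/-! ### The next pivot -/

/-- Update the distance of point `idx` to the pivots. -/
def updateNear : Prog :=
  ite (.and (.nle (.const 1) (.reg Reg.matched)) (.rle (.arr RArr.near (.reg Reg.idx))
      (.dist (.arr Arr.pivot (.reg Reg.matched)) (.reg Reg.idx))))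
    skip
    (rstore RArr.near (.reg Reg.idx) (.dist (.arr Arr.pivot (.reg Reg.matched)) (.reg Reg.idx)))

/-- Update the distance of point `idx` to the pivots, and the farthest point. -/
def updateFarthest : Prog :=
  seq updateNear <|
  ite (.rle (.arr RArr.near (.reg Reg.farthest)) (.arr RArr.near (.reg Reg.idx)))
    (nset Reg.farthest (.reg Reg.idx)) skip

/-- Find a point that is farthest from the pivots. -/
def findFarthest : Prog :=
  seq (nset Reg.farthest (.const 0)) (forTo Reg.idx (.reg Reg.numPoints) updateFarthest)

/-- Make the farthest point the next pivot. -/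
def nextPivot : Prog :=
  seq (nset Reg.matched (.add (.reg Reg.matched) (.const 1))) <|
  seq (nstore Arr.pivot (.reg Reg.matched) (.reg Reg.farthest)) <|
  nset Reg.rowStart (.add (.reg Reg.rowStart) (.reg Reg.numClasses))

/-- Assign pivot `matched` after a successful search, and find the next pivot. -/
def advance : Prog := seq augment (seq findFarthest nextPivot)

/-- The distances of the points below `i` to the pivots have been updated from `near`, and
`farthest` is a farthest one among them. -/
structure FarthestBelow (I : Problem) (j : ℕ) (near : ℕ → ℝ) (i : ℕ) (s : State) : Prop where
  new : ∀ u < i, s.rarr RArr.near u =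
    if j = 0 then I.oracle (s.narr Arr.pivot j) u
    else min (near u) (I.oracle (s.narr Arr.pivot j) u)
  old : ∀ u, i ≤ u → s.rarr RArr.near u = near u
  farthest_lt : s.nreg Reg.farthest < i ∨ i = 0 ∧ s.nreg Reg.farthest = 0
  le_farthest : ∀ u < i, s.rarr RArr.near u ≤ s.rarr RArr.near (s.nreg Reg.farthest)

section

variable {I : Problem} {r : ℝ} {i j : ℕ} {s : State} {near : ℕ → ℝ}

theorem updateNear_haltsWithin (hj : s.nreg Reg.matched = j) (hidx : s.nreg Reg.idx = i) :
    HaltsWithin I.oracle updateNear s 19 fun s' => s'.rarr RArr.near =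
      Function.update (s.rarr RArr.near) i (if j = 0 then I.oracle (s.narr Arr.pivot j) i
        else min (s.rarr RArr.near i) (I.oracle (s.narr Arr.pivot j) i)) := by
  refine .of_loopFree (by simp [updateNear]) (by decide) ?_
  have hpos : 1 ≤ j ↔ j ≠ 0 := Nat.one_le_iff_ne_zero
  by_cases hj0 : j = 0
  · simp [updateNear, hj, hidx, hj0]
  by_cases hle : s.rarr RArr.near i ≤ I.oracle (s.narr Arr.pivot j) i
  · simp [updateNear, hj, hidx, hpos, hj0, hle]
  · simp [updateNear, hj, hidx, hpos, hj0, hle, (not_le.1 hle).le]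

theorem FarthestBelow.update (h : FarthestBelow I j near i s) {s' : State}
    (hpivot : s'.narr Arr.pivot = s.narr Arr.pivot)
    (hnear : s'.rarr RArr.near = Function.update (s.rarr RArr.near) i
      (if j = 0 then I.oracle (s.narr Arr.pivot j) i
        else min (s.rarr RArr.near i) (I.oracle (s.narr Arr.pivot j) i)))
    (hq : s'.nreg Reg.farthest = s.nreg Reg.farthest ∧
        s'.rarr RArr.near i ≤ s'.rarr RArr.near (s.nreg Reg.farthest) ∨
      s'.nreg Reg.farthest = i ∧
        s'.rarr RArr.near (s.nreg Reg.farthest) ≤ s'.rarr RArr.near i) :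
    FarthestBelow I j near (i + 1) s' := by
  have hlt := h.farthest_lt
  have hnear_old {u : ℕ} (hu : u ≠ i) : s'.rarr RArr.near u = s.rarr RArr.near u := by
    rw [hnear, Function.update_of_ne hu]
  refine ⟨fun u hu => ?_, fun u hu => ?_, by omega, fun u hu => ?_⟩
  · rw [hpivot]
    rcases Nat.lt_succ_iff_lt_or_eq.1 hu with hu | rfl
    · rw [hnear_old hu.ne, h.new u hu]
    · rw [hnear, Function.update_self, h.old u le_rfl]
  · rw [hnear_old (by omega), h.old u (by omega)]
  · have hmax : u < i → s'.rarr RArr.near u ≤ s'.rarr RArr.near (s.nreg Reg.farthest) := by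
      intro hu
      rw [hnear_old hu.ne, hnear_old (by omega)]
      exact h.le_farthest u hu
    grind

theorem updateFarthest_haltsWithin (hj : s.nreg Reg.matched = j) (hidx : s.nreg Reg.idx = i)
    (h : FarthestBelow I j near i s) :
    HaltsWithin I.oracle updateFarthest s 30 (FarthestBelow I j near (i + 1)) := by
  refine ((updateNear_haltsWithin hj hidx).seq (T' := 11) fun s₁ hs₁ hnear =>
    HaltsWithin.mono (.of_loopFree (T := 11) (R := fun s' =>
      s'.nreg Reg.farthest = s₁.nreg Reg.farthest ∧
        s₁.rarr RArr.near i ≤ s₁.rarr RArr.near (s₁.nreg Reg.farthest) ∨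
      s'.nreg Reg.farthest = i ∧
        s₁.rarr RArr.near (s₁.nreg Reg.farthest) ≤ s₁.rarr RArr.near i)
      (by simp) (by decide) ?_) le_rfl fun s' hs' hq => h.update ?_ ?_ ?_).mono le_rfl
    fun _ _ h => h
  · have hidx₁ : s₁.nreg Reg.idx = i := (hs₁.nreg _).trans hidx
    by_cases hle : s₁.rarr RArr.near (s₁.nreg Reg.farthest) ≤ s₁.rarr RArr.near i
    · simp [hidx₁, hle]
    · simpa [hidx₁, hle] using (not_le.1 hle).le
  · exact (hs'.narr _).trans (hs₁.narr _)
  · rwa [hs'.rarr RArr.near]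
  · rwa [hs'.rarr RArr.near, ← hs₁.nreg Reg.farthest]

theorem findFarthest_haltsWithin (hI : HasInput I s) (hj : s.nreg Reg.matched = j)
    (hT : Traversal I (s.narr Arr.pivot) j (s.rarr RArr.near)) :
    HaltsWithin I.oracle findFarthest s (40 * I.n + 20) fun s' =>
      Traversal I (Function.update (s'.narr Arr.pivot) (j + 1) (s'.nreg Reg.farthest)) (j + 1)
        (s'.rarr RArr.near) := by
  have init : HaltsWithin I.oracle (nset Reg.farthest (.const 0)) s 2
      (FarthestBelow I j (s.rarr RArr.near) 0) :=
    .of_loopFree (by simp) (by decide) ⟨by simp, by simp, by simp, by simp⟩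
  refine (init.seq fun s₁ hs₁ h₁ => .forTo (x := Reg.idx) I.n
    (FarthestBelow I j (s.rarr RArr.near)) (by decide) (fun s₂ hs₂ => ?_)
    (fun _ _ _ h => ⟨h.1, h.2, h.3, h.4⟩) h₁
    fun i s₂ hs₂ _ hidx h₂ => updateFarthest_haltsWithin ?_ hidx h₂).mono ?_ fun s' hs' h' => ?_
  · exact ((hI.of_eqOff hs₁).of_eqOff hs₂).numPoints
  · exact (hs₂.nreg _).trans ((hs₁.nreg _).trans hj)
  · simp only [NExp.cost]
    omega
  · have hn := hT.pivot_lt 0 (Nat.zero_le j)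
    have hlt := h'.farthest_lt
    rw [← hs'.narr Arr.pivot] at hT
    exact hT.next h'.new (by omega) h'.le_farthest

theorem nextPivot_haltsWithin (hI : HasInput I s) (hj : s.nreg Reg.matched = j)
    (hrow : s.nreg Reg.rowStart = j * I.m) (hA : Assignment I r (j + 1) s)
    (hT : Traversal I (Function.update (s.narr Arr.pivot) (j + 1) (s.nreg Reg.farthest)) (j + 1)
      (s.rarr RArr.near))
    (hE : Edges I j I.n s) :
    HaltsWithin I.oracle nextPivot s 12 fun s' =>
      Matching I r (j + 1) s' ∧ Edges I (j + 1) 0 s' := by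
  have final : HaltsWithin I.oracle nextPivot s 12 fun s' =>
      s'.nreg Reg.matched = j + 1 ∧ s'.nreg Reg.rowStart = (j + 1) * I.m ∧
      s'.narr Arr.pivot = Function.update (s.narr Arr.pivot) (j + 1) (s.nreg Reg.farthest) :=
    .of_loopFree (by simp [nextPivot]) (by decide)
      (by simp [nextPivot, hj, hrow, hI.numClasses, Nat.succ_mul])
  refine final.mono le_rfl fun s' hs ⟨hmatched, hrow', hpivot⟩ =>
    ⟨⟨⟨?_, ?_, fun l hl => ?_⟩, hI.of_eqOff hs, hmatched, hrow', ?_⟩, ?_⟩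
  · rw [hs.narr Arr.load, hs.narr Arr.assigned]
    exact hA.load_eq
  · rw [hs.narr Arr.load]
    exact hA.load_le
  · rw [hs.narr Arr.assigned, hs.narr Arr.center, Near, hpivot, Function.update_of_ne hl.ne]
    exact hA.center l hl
  · rwa [hpivot, hs.rarr RArr.near]
  · rw [Edges, hpivot, hs.narr Arr.edgePivot, hs.narr Arr.edgePoint]
    exact hE.next _

theorem Assignment.of_eqOff {W : List Loc} {s' : State} (h : Assignment I r j s)
    (hs : EqOff W s s')
    (hW : ∀ l ∈ [Loc.narr Arr.pivot, .narr Arr.assigned, .narr Arr.load, .narr Arr.center], l ∉ W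
      := by decide) : Assignment I r j s' where
  load_eq := by
    rw [hs.narr Arr.load (hW _ (by decide)), hs.narr Arr.assigned (hW _ (by decide))]
    exact h.load_eq
  load_le := by
    rw [hs.narr Arr.load (hW _ (by decide))]
    exact h.load_le
  center := by
    rw [hs.narr Arr.assigned (hW _ (by decide)), hs.narr Arr.center (hW _ (by decide)),
      hs.narr Arr.pivot (hW _ (by decide))]
    exact h.center

theorem advance_haltsWithin (h : Searching I r j s) (hstatus : s.nreg Reg.status = 1) :
    HaltsWithin I.oracle advance s (29 * (I.m + 1) + 40 * I.n + 42) fun s' =>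
      Matching I r (j + 1) s' ∧ Edges I (j + 1) 0 s' := by
  refine ((augment_haltsWithin h hstatus).seq fun s₁ hs₁ hA => (findFarthest_haltsWithin
    (j := j) (h.matching.input.of_eqOff hs₁) ?_ ?_).seq fun s₂ hs₂ hT => nextPivot_haltsWithin
      ((h.matching.input.of_eqOff hs₁).of_eqOff hs₂) ?_ ?_ (hA.of_eqOff hs₂) hT
        ((h.edges.of_eqOff hs₁).of_eqOff hs₂)).mono (by omega) fun _ _ h => h
  · exact (hs₁.nreg _).trans h.matching.matched
  · rw [hs₁.narr Arr.pivot, hs₁.rarr RArr.near]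
    exact h.matching.traversal
  · exact (hs₂.nreg _).trans ((hs₁.nreg _).trans h.matching.matched)
  · exact (hs₂.nreg _).trans ((hs₁.nreg _).trans h.matching.rowStart)

end

/-- Assign the next pivot to a class, or find out that there are enough pivots. -/
def round : Prog :=
  seq fillRow <| seq startSearch <| seq search <|
    ite (.nle (.reg Reg.status) (.const 1)) advance skip

/-- Rounds are carried out until there are `k` pivots or the search for a class fails. -/
def assignPivots : Prog :=
  loop (.and (.not (.nle (.reg Reg.numCenters) (.reg Reg.matched)))
    (.nle (.reg Reg.status) (.const 1))) round

/-- The state between two rounds: if the status is not `2`, then there can be another one. -/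
structure BetweenRounds (I : Problem) (r : ℝ) (s : State) : Prop where
  matching : Matching I r (s.nreg Reg.matched) s
  le_k : s.nreg Reg.matched ≤ I.k
  outcome : (s.nreg Reg.status ≤ 1 ∧ Edges I (s.nreg Reg.matched) 0 s) ∨
    (s.nreg Reg.status = 2 ∧ s.nreg Reg.matched ≠ 0 ∧
      s.rarr RArr.near (s.narr Arr.pivot (s.nreg Reg.matched)) ≤ 2 * r)

section

variable {I : Problem} {r : ℝ} {j : ℕ} {s : State} {T : Finset ℕ}

theorem startSearch_searching (h : Matching I r j s) (hE : Edges I j I.n s) :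
    HaltsWithin I.oracle startSearch s (20 * I.m + 20) (Searching I r j) := by
  refine (startSearch_haltsWithin h.input h.matched).mono le_rfl
    fun s' hs ⟨hassigned, hroot, hfresh, hclock, hstatus⟩ => ⟨?_, hE.of_eqOff hs, ?_, ?_, ?_⟩
  · exact h.of_eqOff hs fun l hl => by rw [hassigned, Function.update_of_ne hl.ne]
  · rw [hassigned, Function.update_self]
  · rw [hclock]
    exact .start hroot hfresh
  · refine .inl ⟨hstatus, fun c hc => ?_⟩
    rw [Problem.quo_of_le (not_lt.1 fun hlt => (mem_reached.1 hc).2 (hfresh c hlt))]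
    exact Nat.zero_le _

theorem round_time_le {n m k j : ℕ} (hm : m ≠ 0) (hj : j < k) :
    60 * n + 60 + (20 * m + 20 + ((m + 2) * (60 * (j * m + m) + 128) + 3 +
      (3 + (29 * (m + 1) + 40 * n + 42)))) ≤ 100 * n + 800 * (k * m ^ 2) := by
  have hrow : j * m + m ≤ k * m := by
    rw [← Nat.succ_mul]
    exact Nat.mul_le_mul_right m hj
  have hkm : m ≤ k * m := Nat.le_mul_of_pos_left m (by omega)
  have hkmm : k * m ≤ k * m ^ 2 := Nat.mul_le_mul_left k (Nat.le_self_pow two_ne_zero m)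
  have hsearch : (m + 2) * (60 * (j * m + m) + 128) ≤ 3 * m * (188 * (k * m)) :=
    Nat.mul_le_mul (by omega) (by omega)
  have : 3 * m * (188 * (k * m)) = 564 * (k * m ^ 2) := by ring
  omega

theorem round_haltsWithin (h : Matching I r j s) (hE : Edges I j 0 s) (hT : I.Cover T r)
    (hj : j < I.k) :
    HaltsWithin I.oracle round s (100 * I.n + 800 * (I.k * I.m ^ 2)) fun s' =>
      (Matching I r (j + 1) s' ∧ s'.nreg Reg.status ≤ 1 ∧ Edges I (j + 1) 0 s') ∨
      (Matching I r j s' ∧ s'.nreg Reg.status = 2 ∧ j ≠ 0 ∧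
        s'.rarr RArr.near (s'.narr Arr.pivot j) ≤ 2 * r) := by
  have hm : I.m ≠ 0 := (Problem.col_lt (h.traversal.pivot_lt 0 (Nat.zero_le j))).ne_bot
  refine ((fillRow_haltsWithin h hE).seq fun s₁ hs₁ hE₁ => (startSearch_searching
    (h.of_eqOff hs₁ fun l _ => congrFun (hs₁.narr _) l) hE₁).seq fun s₂ _ h₂ =>
      (search_haltsWithin h₂ hT hj).seq fun s₃ _ ⟨h₃, hstatus₃⟩ =>
        HaltsWithin.ite (T := 29 * (I.m + 1) + 40 * I.n + 42) (fun hb => ?_) fun hb => ?_).mono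
    (round_time_le hm hj) fun _ _ h => h
  · have hle : s₃.nreg Reg.status ≤ 1 := hb
    refine (advance_haltsWithin h₃ (by omega)).mono le_rfl fun s' hs h' => ?_
    exact .inl ⟨h'.1, (hs.nreg Reg.status).trans_le hle, h'.2⟩
  · have hlt : 1 < s₃.nreg Reg.status := not_le.1 hb
    have := h₃.outcome.resolve_left (by omega) |>.resolve_left (by omega)
    exact (HaltsWithin.of_loopFree (P := skip) (T := 1) (by simp) le_rfl
      (.inr ⟨h₃.matching, this⟩)).mono (by omega) fun _ _ h => h

theorem Matching.exists_center_near (h : Matching I r j s) (hj : j ≠ 0)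
    (hnear : s.rarr RArr.near (s.narr Arr.pivot j) ≤ 2 * r) {u : ℕ} (hu : u < I.n) :
    ∃ l < j, I.oracle u (s.narr Arr.center l) ≤ 3 * r := by
  obtain ⟨l, hl, hul⟩ := h.traversal.exists_pivot_near hj hnear hu
  obtain ⟨-, -, hlt, hle⟩ := h.center l hl
  have := Problem.oracle_triangle hu hlt (h.traversal.pivot_lt l hl.le)
  exact ⟨l, hl, by linarith⟩

theorem assignPivots_haltsWithin (h : BetweenRounds I r s) (hT : I.Cover T r) (hk : 1 ≤ I.k) :
    HaltsWithin I.oracle assignPivots s (I.k * (100 * I.n + 800 * (I.k * I.m ^ 2) + 8) + 8)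
      fun s' => BetweenRounds I r s' ∧
        ∀ u < I.n, ∃ l < s'.nreg Reg.matched, I.oracle u (s'.narr Arr.center l) ≤ 3 * r := by
  refine (HaltsWithin.loop (T := 100 * I.n + 800 * (I.k * I.m ^ 2)) (BetweenRounds I r)
    (fun s' => if s'.nreg Reg.status ≤ 1 then I.k - s'.nreg Reg.matched else 0) h
    fun s₁ _ h₁ hb => ?_).mono ?_ fun s' _ ⟨h', hb⟩ => ⟨h', fun u hu => ?_⟩
  · obtain ⟨hlt, hstatus⟩ : ¬ s₁.nreg Reg.numCenters ≤ s₁.nreg Reg.matched ∧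
      s₁.nreg Reg.status ≤ 1 := hb
    rw [h₁.matching.input.numCenters, not_le] at hlt
    have hE := h₁.outcome.resolve_right (by omega) |>.2
    refine (round_haltsWithin h₁.matching hE hT hlt).mono le_rfl fun s₂ _ h₂ => ?_
    rw [if_pos hstatus]
    rcases h₂ with ⟨hM, hstatus₂, hE₂⟩ | ⟨hM, hstatus₂, hcovers⟩ <;> have hj₂ := hM.matched
    · rw [if_pos hstatus₂]
      rw [← hj₂] at hM hE₂
      exact ⟨⟨hM, by omega, .inl ⟨hstatus₂, hE₂⟩⟩, by omega⟩
    · rw [if_neg (by omega)]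
      rw [← hj₂] at hM hcovers
      exact ⟨⟨hM, by omega, .inr ⟨hstatus₂, hcovers⟩⟩, by omega⟩
  · refine Nat.add_le_add (Nat.mul_le_mul ?_ ?_) (by decide)
    · split_ifs <;> omega
    · simp only [BExp.cost, NExp.cost]
      omega
  · rcases h'.outcome with ⟨hstatus, -⟩ | ⟨-, hne, hle⟩
    · have hkj : I.k ≤ s'.nreg Reg.matched := by
        simpa [h'.matching.input.numCenters, hstatus] using hb
      exact h'.matching.exists_center_near (by omega)
        (hT.near_le_of_card_lt h'.matching.traversal hkj) hu
    · exact h'.matching.exists_center_near hne hle hu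

theorem betweenRounds_input (h : 0 < I.n) : BetweenRounds I r I.input where
  matching :=
    { load_eq := fun _ => rfl
      load_le := fun _ => Nat.zero_le _
      center := fun _ hl => absurd hl (Nat.not_lt_zero _)
      input := ⟨rfl, rfl, rfl, rfl, rfl⟩
      matched := rfl
      rowStart := (Nat.zero_mul _).symm
      traversal := .start h _ }
  le_k := Nat.zero_le _
  outcome := .inl ⟨Nat.zero_le _, .empty I _ _⟩

end

/-! ### Completing a set greedily -/

/-- Add the point `u` to `S` if the quota of its class is not exhausted. -/
def offer (I : Problem) (S : Finset ℕ) (u : ℕ) : Finset ℕ :=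
  if #{v ∈ S | I.col v = I.col u} < I.quo (I.col u) then insert u S else S

/-- Offer `f 0, …, f (i - 1)` to `S`. -/
def greedy (I : Problem) (S : Finset ℕ) (f : ℕ → ℕ) : ℕ → Finset ℕ
  | 0 => S
  | i + 1 => offer I (greedy I S f i) (f i)

section

variable {I : Problem} {S : Finset ℕ} {f : ℕ → ℕ} {i j u : ℕ}

theorem subset_offer : S ⊆ offer I S u := by
  unfold offer
  split_ifs
  · exact subset_insert u S
  · exact Subset.rfl

theorem greedy_mono (I : Problem) (S : Finset ℕ) (f : ℕ → ℕ) : Monotone (greedy I S f) :=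
  monotone_nat_of_le_succ fun _ => subset_offer

theorem offer_subset_insert : offer I S u ⊆ insert u S := by
  unfold offer
  split_ifs
  · exact Subset.rfl
  · exact subset_insert u S

theorem greedy_lt (hS : ∀ v ∈ S, v < I.n) (hf : ∀ i < j, f i < I.n) :
    ∀ v ∈ greedy I S f j, v < I.n := by
  induction j with
  | zero => exact hS
  | succ j ih =>
    intro v hv
    rcases mem_insert.1 (offer_subset_insert hv) with rfl | hv
    · exact hf j j.lt_succ_self
    · exact ih (fun i hi => hf i (hi.trans j.lt_succ_self)) v hv

theorem card_filter_offer_le (hS : ∀ c, #{v ∈ S | I.col v = c} ≤ I.quo c) (c : ℕ) :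
    #{v ∈ offer I S u | I.col v = c} ≤ I.quo c := by
  unfold offer
  split_ifs with hroom
  · rw [filter_insert]
    split_ifs with hc
    · subst hc
      exact (card_insert_le _ _).trans hroom
    · exact hS c
  · exact hS c

theorem card_filter_greedy_le (hS : ∀ c, #{v ∈ S | I.col v = c} ≤ I.quo c) (i c : ℕ) :
    #{v ∈ greedy I S f i | I.col v = c} ≤ I.quo c := by
  induction i generalizing c with
  | zero => exact hS c
  | succ i ih => exact card_filter_offer_le ih c

theorem mem_greedy_or_quo_le (hi : i < j) :
    f i ∈ greedy I S f j ∨ I.quo (I.col (f i)) ≤ #{v ∈ greedy I S f j | I.col v = I.col (f i)} := by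
  by_cases hroom : #{v ∈ greedy I S f i | I.col v = I.col (f i)} < I.quo (I.col (f i))
  · refine .inl (greedy_mono I S f hi ?_)
    rw [greedy, offer, if_pos hroom]
    exact mem_insert_self _ _
  · exact .inr ((not_lt.1 hroom).trans
      (card_le_card (filter_subset_filter _ (greedy_mono I S f hi.le))))

theorem greedy_empty_subset_image : greedy I ∅ f j ⊆ (range j).image f := by
  induction j with
  | zero => exact empty_subset _
  | succ j ih =>
    rw [range_add_one, image_insert]
    exact offer_subset_insert.trans (insert_subset_insert _ ih)

theorem mem_greedy_empty (hload : ∀ c, load (fun l => I.col (f l)) j c ≤ I.quo c) (hi : i < j) :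
    f i ∈ greedy I ∅ f j := by
  by_contra hrejected
  have hsub : {v ∈ greedy I ∅ f j | I.col v = I.col (f i)} ⊆
      ({l ∈ range j | I.col (f l) = I.col (f i)}.erase i).image f := by
    intro v hv
    obtain ⟨hv, hcol⟩ := mem_filter.1 hv
    obtain ⟨l, hl, rfl⟩ := mem_image.1 (greedy_empty_subset_image hv)
    have hli : l ≠ i := fun h => hrejected (h ▸ hv)
    exact mem_image_of_mem f (mem_erase.2 ⟨hli, mem_filter.2 ⟨hl, hcol⟩⟩)
  have hi' : i ∈ {l ∈ range j | I.col (f l) = I.col (f i)} := by simpa using hi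
  have hlt := ((card_le_card hsub).trans card_image_le).trans_lt (card_erase_lt_of_mem hi')
  exact ((mem_greedy_or_quo_le hi).resolve_left hrejected).not_gt (hlt.trans_le (hload _))

theorem Problem.Cover.greedy_fair {T : Finset ℕ} {r : ℝ} (hT : I.Cover T r)
    (hS : ∀ c, #{v ∈ S | I.col v = c} ≤ I.quo c) (c : ℕ) :
    #{v ∈ greedy I S id I.n | I.col v = c} = I.quo c := by
  refine (card_filter_greedy_le hS _ c).antisymm (not_lt.1 fun hlt => hlt.not_ge ?_)
  rw [← hT.fair c]
  refine card_le_card fun t ht => ?_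
  obtain ⟨htT, rfl⟩ := mem_filter.1 ht
  refine mem_filter.2 ⟨(mem_greedy_or_quo_le (f := id) (hT.lt t htT)).resolve_right hlt.not_ge, rfl⟩

end

/-- Room is left for the point in register `candidate`, which has not been chosen yet. -/
def isAddable : BExp :=
  .and (.nle (.arr Arr.chosen (.reg Reg.candidate)) (.const 0))
    (.nle (.add (.arr Arr.chosenCount (.arr Arr.classOf (.reg Reg.candidate))) (.const 1))
      (.arr Arr.quota (.arr Arr.classOf (.reg Reg.candidate))))

/-- Offer the point in register `candidate` to the set of chosen points. -/
def offerCandidate : Prog :=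
  ite isAddable
    (seq (nstore Arr.chosen (.reg Reg.candidate) (.const 1)) <|
     seq (nstore Arr.chosenCount (.arr Arr.classOf (.reg Reg.candidate))
       (.add (.arr Arr.chosenCount (.arr Arr.classOf (.reg Reg.candidate))) (.const 1))) <|
     seq (nstore Arr.output (.reg Reg.outSize) (.reg Reg.candidate)) <|
     nset Reg.outSize (.add (.reg Reg.outSize) (.const 1)))
    skip

/-- Offer the values of `e` for `idx = 0, …, N - 1` to the set of chosen points. -/
def offerAll (N e : NExp) : Prog := forTo Reg.idx N (seq (nset Reg.candidate e) offerCandidate)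

/-- The set of chosen points is `S`. -/
structure Chosen (I : Problem) (S : Finset ℕ) (s : State) : Prop where
  chosen : ∀ u, s.narr Arr.chosen u = if u ∈ S then 1 else 0
  chosenCount : ∀ c, s.narr Arr.chosenCount c = #{u ∈ S | I.col u = c}
  outSize : s.nreg Reg.outSize = #S
  output : (range #S).image (s.narr Arr.output) = S

section

variable {I : Problem} {S : Finset ℕ} {f : ℕ → ℕ} {B u : ℕ} {s s' : State}

theorem Chosen.of_eqOff {W : List Loc} (h : Chosen I S s) (hs : EqOff W s s')
    (hW : ∀ l ∈ [Loc.narr Arr.chosen, .narr Arr.chosenCount, .nreg Reg.outSize, .narr Arr.output],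
      l ∉ W := by decide) : Chosen I S s' where
  chosen := by
    rw [hs.narr Arr.chosen (hW _ (by decide))]
    exact h.chosen
  chosenCount := by
    rw [hs.narr Arr.chosenCount (hW _ (by decide))]
    exact h.chosenCount
  outSize := (hs.nreg _ (hW _ (by decide))).trans h.outSize
  output := by
    rw [hs.narr Arr.output (hW _ (by decide))]
    exact h.output

theorem Chosen.insert (h : Chosen I S s) (hu : u ∉ S)
    (hchosen : s'.narr Arr.chosen = Function.update (s.narr Arr.chosen) u 1)
    (hcount : s'.narr Arr.chosenCount = Function.update (s.narr Arr.chosenCount) (I.col u)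
      (s.narr Arr.chosenCount (I.col u) + 1))
    (houtput : s'.narr Arr.output = Function.update (s.narr Arr.output) (s.nreg Reg.outSize) u)
    (hsize : s'.nreg Reg.outSize = s.nreg Reg.outSize + 1) : Chosen I (insert u S) s' where
  chosen v := by
    rw [hchosen, Function.update_apply, h.chosen]
    grind
  chosenCount c := by
    rw [hcount, filter_insert]
    rcases eq_or_ne c (I.col u) with rfl | hc
    · rw [Function.update_self, h.chosenCount, if_pos rfl, card_insert_of_notMem (by simp [hu])]
    · rw [Function.update_of_ne hc, h.chosenCount, if_neg hc.symm]
  outSize := by rw [hsize, h.outSize, card_insert_of_notMem hu]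
  output := by
    rw [card_insert_of_notMem hu, range_add_one, image_insert, houtput, h.outSize,
      Function.update_self]
    congr 1
    refine (image_congr fun l hl => ?_).trans h.output
    exact Function.update_of_ne (mem_range.1 hl).ne _ _

theorem offerCandidate_haltsWithin (hI : HasInput I s) (hu : s.nreg Reg.candidate = u)
    (h : Chosen I S s) : HaltsWithin I.oracle offerCandidate s 40 (Chosen I (offer I S u)) := by
  have htest : isAddable.eval I.oracle s ↔
      u ∉ S ∧ #{v ∈ S | I.col v = I.col u} < I.quo (I.col u) := by
    simp [isAddable, hu, hI.classOf, hI.quota, h.chosen, h.chosenCount]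
  refine .of_loopFree (by simp [offerCandidate]) (by decide) ?_
  rw [offerCandidate, final]
  split_ifs with hadd
  · obtain ⟨hnew, hroom⟩ := htest.1 hadd
    rw [offer, if_pos hroom]
    exact h.insert hnew (by simp [hu]) (by simp [hu, hI.classOf]) (by simp [hu]) (by simp)
  · rw [htest, not_and] at hadd
    have : offer I S u = S := by
      unfold offer
      grind
    simpa [this] using h

theorem offerAll_haltsWithin {N e : NExp} (hI : HasInput I s) (h : Chosen I S s)
    (hN : ∀ s', EqOff (.nreg Reg.idx :: (seq (nset Reg.candidate e) offerCandidate).writes) s s' →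
      N.eval s' = B)
    (he : ∀ s', EqOff (.nreg Reg.idx :: (seq (nset Reg.candidate e) offerCandidate).writes) s s' →
      e.eval s' = f (s'.nreg Reg.idx)) :
    HaltsWithin I.oracle (offerAll N e) s (B * (N.cost + (e.cost + 41) + 7) + (N.cost + 5))
      (Chosen I (greedy I S f B)) := by
  refine .forTo B (fun i => Chosen I (greedy I S f i)) (by simp [offerCandidate, Prog.writes]) hN
    (fun _ _ _ h => ⟨h.1, h.2, h.3, h.4⟩) h fun i s₁ hs₁ _ hidx h₁ => ?_
  have hI₁ : HasInput I s₁ := hI.of_eqOff hs₁ (by simp [offerCandidate, Prog.writes])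
  have init : HaltsWithin I.oracle (nset Reg.candidate e) s₁ (e.cost + 1)
      fun s₂ => s₂.nreg Reg.candidate = f i :=
    .of_loopFree (by simp) le_rfl (by simp [he s₁ hs₁, hidx])
  exact (init.seq fun s₂ hs₂ hcand => offerCandidate_haltsWithin
    (hI₁.of_eqOff hs₂ (by simp [Prog.writes])) hcand
    (h₁.of_eqOff hs₂ (by simp [Prog.writes]))).mono (by omega) fun _ _ h => h

end

/-- For `k = 1` no centers are assigned: this would take time `m ^ 2`, and every point will do. -/
def chooseCenters : Prog := ite (.nle (.reg Reg.numCenters) (.const 1)) skip assignPivots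

/-- Output a fair set that contains the assigned centers. -/
def completeCenters : Prog :=
  seq (offerAll (.reg Reg.matched) (.arr Arr.center (.reg Reg.idx))) <|
  offerAll (.reg Reg.numPoints) (.reg Reg.idx)

/-- The 3-approximation algorithm for fair `k`-center. -/
def fairCenter : Prog := seq chooseCenters completeCenters

section

variable {I : Problem} {r : ℝ} {T F : Finset ℕ} {s : State}

theorem Problem.Cover.of_k_eq_one (hT : I.Cover T r) (hk : I.k = 1) (hF : ∀ v ∈ F, v < I.n)
    (hfair : ∀ c, #{v ∈ F | I.col v = c} = I.quo c) : I.Cover F (2 * r) where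
  lt := hF
  fair := hfair
  cover u hu := by
    obtain ⟨t, ht, hut⟩ := hT.cover u hu
    have hquo : 0 < I.quo (I.col t) := by
      rw [← hT.fair, card_pos]
      exact ⟨t, mem_filter.2 ⟨ht, rfl⟩⟩
    rw [← hfair, card_pos] at hquo
    obtain ⟨v, hvt⟩ := hquo
    have hv := (mem_filter.1 hvt).1
    obtain ⟨t', ht', hvt⟩ := hT.cover v (hF v hv)
    obtain rfl := card_le_one.1 (hT.card_eq.trans hk).le t' ht' t ht
    have := I.oracle_triangle hu (hF v hv) (hT.lt t' ht')
    rw [I.oracle_comm t'] at this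
    exact ⟨v, hv, by linarith⟩

theorem Problem.Cover.n_pos (hT : I.Cover T r) (hk : 1 ≤ I.k) : 0 < I.n := by
  obtain ⟨t, ht⟩ := card_pos.1 (hk.trans_eq hT.card_eq.symm)
  exact (Nat.zero_le t).trans_lt (hT.lt t ht)

theorem chooseCenters_haltsWithin (hT : I.Cover T r) (hk : 1 ≤ I.k) (hn : 0 < I.n) :
    HaltsWithin I.oracle chooseCenters I.input
      (3 + if I.k = 1 then 1 else I.k * (100 * I.n + 800 * (I.k * I.m ^ 2) + 8) + 8) fun s' =>
        BetweenRounds I r s' ∧ (I.k = 1 ∨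
          ∀ u < I.n, ∃ l < s'.nreg Reg.matched, I.oracle u (s'.narr Arr.center l) ≤ 3 * r) := by
  have h := betweenRounds_input (r := r) hn
  have htest : (BExp.nle (.reg Reg.numCenters) (.const 1)).eval I.oracle I.input ↔ I.k = 1 := by
    simpa [h.matching.input.numCenters] using hk.ge_iff_eq'
  refine .ite (fun hone => ?_) fun hmany => ?_
  · rw [htest] at hone
    exact .of_loopFree (by simp) (by simp [hone, Prog.time]) ⟨h, .inl hone⟩
  · rw [if_neg (mt htest.2 hmany)]
    exact (assignPivots_haltsWithin h hT hk).mono le_rfl fun _ _ h' => ⟨h'.1, .inr h'.2⟩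

theorem Assignment.load_col_center_le {j : ℕ} (h : Assignment I r j s) (c : ℕ) :
    load (fun l => I.col (s.narr Arr.center l)) j c ≤ I.quo c := by
  rw [load_congr (b := s.narr Arr.assigned) fun l hl => (h.center l hl).2.1, ← h.load_eq]
  exact h.load_le c

theorem Assignment.cover_greedy {j : ℕ} (h : Assignment I r j s) (hT : I.Cover T r)
    (hnear : I.k = 1 ∨ ∀ u < I.n, ∃ l < j, I.oracle u (s.narr Arr.center l) ≤ 3 * r) :
    I.Cover (greedy I (greedy I ∅ (s.narr Arr.center) j) id I.n) (3 * r) := by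
  set S := greedy I ∅ (s.narr Arr.center) j
  have hlt := greedy_lt (j := I.n) (f := id) (greedy_lt (j := j) (S := ∅) (by simp)
    fun l hl => (h.center l hl).2.2.1) fun _ => id
  have hfair := hT.greedy_fair (S := S) (card_filter_greedy_le (by simp) j)
  rcases hnear with hone | hnear
  · have hF := hT.of_k_eq_one hone hlt hfair
    refine ⟨hlt, hfair, fun u hu => ?_⟩
    obtain ⟨t, -, hut⟩ := hT.cover u hu
    obtain ⟨v, hv, huv⟩ := hF.cover u hu
    have := I.oracle_nonneg u t
    exact ⟨v, hv, by linarith⟩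
  · refine ⟨hlt, hfair, fun u hu => ?_⟩
    obtain ⟨l, hl, hul⟩ := hnear u hu
    exact ⟨_, greedy_mono I S id (Nat.zero_le I.n) (mem_greedy_empty h.load_col_center_le hl), hul⟩

theorem completeCenters_haltsWithin {j : ℕ} (h : Matching I r j s) (hchosen : Chosen I ∅ s)
    (hT : I.Cover T r)
    (hnear : I.k = 1 ∨ ∀ u < I.n, ∃ l < j, I.oracle u (s.narr Arr.center l) ≤ 3 * r) :
    HaltsWithin I.oracle completeCenters s (51 * j + 6 + (50 * I.n + 6)) fun s' =>
      I.Cover ((range I.k).image (s'.narr Arr.output)) (3 * r) := by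
  refine ((offerAll_haltsWithin (N := .reg Reg.matched) (e := .arr Arr.center (.reg Reg.idx))
    (B := j) (f := s.narr Arr.center) h.input hchosen (fun s₁ hs₁ => ?_) fun s₁ hs₁ => ?_).seq
    fun s₁ hs₁ h₁ => offerAll_haltsWithin (N := .reg Reg.numPoints) (e := .reg Reg.idx) (B := I.n)
      (f := id) (h.input.of_eqOff hs₁) h₁ (fun s₂ hs₂ => ?_) fun _ _ => rfl).mono ?_
    fun s' _ h' => ?_
  · exact (hs₁.nreg _).trans h.matched
  · exact congrFun (hs₁.narr _) _
  · exact (hs₂.nreg _).trans (h.input.of_eqOff hs₁).numPoints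
  · simp only [NExp.cost]
    omega
  · have hF := h.toAssignment.cover_greedy hT hnear
    rwa [← hF.card_eq, h'.output]

theorem fairCenter_time_le {n m k : ℕ} (hn : 0 < n) (hk : 1 ≤ k) :
    (3 + if k = 1 then 1 else k * (100 * n + 800 * (k * m ^ 2) + 8) + 8) +
      (51 * k + 6 + (50 * n + 6)) ≤ 250 * (k * n) + if k = 1 then 0 else 800 * (m ^ 2 * k ^ 2) := by
  have hkn : k ≤ k * n := Nat.le_mul_of_pos_right k hn
  have hnk : n ≤ k * n := Nat.le_mul_of_pos_left n hk
  split_ifs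
  · omega
  · have : k * (100 * n + 800 * (k * m ^ 2) + 8) =
        100 * (k * n) + 800 * (m ^ 2 * k ^ 2) + 8 * k := by ring
    omega

theorem chosen_input : Chosen I ∅ I.input := ⟨fun _ => rfl, fun _ => rfl, rfl, rfl⟩

theorem fairCenter_haltsWithin (hT : I.Cover T r) (hk : 1 ≤ I.k) :
    HaltsWithin I.oracle fairCenter I.input
      (250 * (I.k * I.n) + if I.k = 1 then 0 else 800 * (I.m ^ 2 * I.k ^ 2)) fun s =>
        I.Cover ((range I.k).image (s.narr Arr.output)) (3 * r) := by
  have hn := hT.n_pos hk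
  exact ((chooseCenters_haltsWithin hT hk hn).seq fun s₁ hs₁ ⟨h₁, hnear⟩ =>
    (completeCenters_haltsWithin h₁.matching (chosen_input.of_eqOff hs₁) hT hnear).mono
      (Nat.add_le_add_right (Nat.add_le_add_right (Nat.mul_le_mul_left 51 h₁.le_k) 6) _)
      fun _ _ h => h).mono (fairCenter_time_le hn hk) fun _ _ h => h

theorem time_le_log {n m k : ℕ} (hk : 1 ≤ k) :
    ((250 * (k * n) + if k = 1 then 0 else 800 * (m ^ 2 * k ^ 2) : ℕ) : ℝ) ≤
      1600 * ((k : ℝ) * n + (m : ℝ) ^ 2 * (k : ℝ) ^ 2 * Real.log k) := by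
  have hkn : (0 : ℝ) ≤ (k : ℝ) * n := by positivity
  rcases hk.eq_or_lt with rfl | hk
  · rw [if_pos rfl, Nat.cast_one, Real.log_one]
    push_cast
    linarith
  · have hlog : 1 / 2 ≤ Real.log k := by
      have := Real.log_le_log two_pos (Nat.ofNat_le_cast.2 hk)
      linarith [Real.log_two_gt_d9]
    have := mul_le_mul_of_nonneg_left hlog (by positivity : (0 : ℝ) ≤ (m : ℝ) ^ 2 * (k : ℝ) ^ 2)
    rw [if_neg hk.ne']
    push_cast
    linarith

end

namespace Problem

variable {I : Problem} {S : Finset (Fin I.n)} {r : ℝ}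

theorem isFair_iff :
    I.IsFair S ↔ ∀ i, #{t ∈ S.map Fin.valEmbedding | I.col t = i} = I.quo i := by
  have hcard (i : ℕ) :
      #{t ∈ S.map Fin.valEmbedding | I.col t = i} = #{t ∈ S | (I.color t : ℕ) = i} := by
    rw [filter_map, card_map]
    exact congrArg card (filter_congr fun t _ => by simp [col_val])
  refine ⟨fun h i => ?_, fun h i => ?_⟩
  · rw [hcard]
    by_cases hi : i < I.m
    · exact (congrArg card (filter_congr fun t _ => Fin.ext_iff.symm)).trans
        ((h ⟨i, hi⟩).trans (quo_val ⟨i, hi⟩).symm)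
    · rw [quo_of_le (not_lt.1 hi), card_eq_zero, filter_eq_empty_iff]
      exact fun t _ ht => hi (ht ▸ (I.color t).2)
  · rw [← quo_val, ← h, hcard]
    exact congrArg card (filter_congr fun t _ => Fin.ext_iff)

theorem nonempty_of_isFair (hk : 1 ≤ I.k) (h : I.IsFair S) : S.Nonempty := by
  rw [nonempty_iff_ne_empty]
  rintro rfl
  have : I.k = 0 := Finset.sum_eq_zero fun i _ => (h i).symm
  omega

theorem IsFair.cover (hk : 1 ≤ I.k) (h : I.IsFair S) :
    I.Cover (S.map Fin.valEmbedding) (I.radius S) where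
  lt t ht := by
    obtain ⟨t, -, rfl⟩ := mem_map.1 ht
    exact t.2
  fair := isFair_iff.1 h
  cover u hu := by
    have := (nonempty_of_isFair hk h).to_subtype
    obtain ⟨t, ht⟩ := exists_eq_ciInf_of_finite (f := fun t : S => I.dist ⟨u, hu⟩ t)
    refine ⟨t, mem_map_of_mem _ t.2, (oracle_val ⟨u, hu⟩ t).trans_le (ht.trans_le ?_)⟩
    exact le_ciSup (f := fun u => ⨅ t : S, I.dist u t) (Set.finite_range _).bddAbove ⟨u, hu⟩

theorem Cover.radius_le (h : I.Cover (S.map Fin.valEmbedding) r) (hn : 0 < I.n) :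
    I.radius S ≤ r := by
  have : Nonempty (Fin I.n) := ⟨⟨0, hn⟩⟩
  refine ciSup_le fun u => ?_
  obtain ⟨t, ht, hle⟩ := h.cover u u.2
  obtain ⟨v, hv, rfl⟩ := mem_map.1 ht
  rw [Fin.valEmbedding_apply, oracle_val] at hle
  exact ciInf_le_of_le (Set.finite_range _).bddBelow ⟨v, hv⟩ hle

theorem exists_isFair_forall_radius_le (h : ∃ S, I.IsFair S) :
    ∃ S, I.IsFair S ∧ ∀ S', I.IsFair S' → I.radius S ≤ I.radius S' := by
  classical
  obtain ⟨S₀, hS₀⟩ := h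
  obtain ⟨S, hS, hmin⟩ := exists_min_image {S | I.IsFair S} I.radius ⟨S₀, by simpa using hS₀⟩
  exact ⟨S, by simpa using hS, fun S' hS' => hmin S' (by simpa using hS')⟩

end Problem

end FairKCenter

theorem mainTheorem9 :
    ∃ (P : FairKCenter.Prog) (C : ℝ), ∀ I : FairKCenter.Problem,
      1 ≤ I.k → (∃ T, I.IsFair T) →
        I.SolvedBy P 3
          (C * ((I.k : ℝ) * I.n + (I.m : ℝ) ^ 2 * (I.k : ℝ) ^ 2 * Real.log I.k)) := by
  refine ⟨FairKCenter.fairCenter, 1600, fun I hk hI => ?_⟩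
  obtain ⟨T, hT, hmin⟩ := FairKCenter.Problem.exists_isFair_forall_radius_le hI
  obtain ⟨t, s, hexec, ht, hF⟩ := FairKCenter.fairCenter_haltsWithin (hT.cover hk) hk
  have houtputs := Finset.map_valEmbedding_attachFin hF.lt
  set S := Finset.attachFin _ hF.lt
  have hcover : I.Cover (S.map Fin.valEmbedding) (3 * I.radius T) := houtputs.symm ▸ hF
  have hfair : I.IsFair S := FairKCenter.Problem.isFair_iff.2 hcover.fair
  have hradius : I.radius S ≤ 3 * I.radius T := hcover.radius_le (hF.n_pos hk)
  have htime := (Nat.cast_le.2 ht).trans (FairKCenter.time_le_log hk)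
  exact ⟨t, s, S, hexec, htime, houtputs.symm, hfair, fun T' hT' =>
    hradius.trans (mul_le_mul_of_nonneg_left (hmin T' hT') zero_le_three)⟩
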